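/- **Setting.** In Online Generalized Load Balancing there are $m$ machines, a norm $\|\cdot\|$ on $\mathbb{R}^m$, and jobs $t=1,\dots,T$ that arrive one by one. Job $t$ is a non-negative matrix $C^{(t)}\in\mathbb{R}_{\ge 0}^{m\times k}$ whose $j$-th column is the vector of loads that the machines incur if the job is processed with option $j\in\{1,\dots,k\}$, $k\ge 1$. When job $t$ arrives, an online algorithm has to select an option for it, i.e. a vector $x^{(t)}\in\{0,1\}^k$ with exactly one entry $1$, as a function of $C^{(1)},\dots,C^{(t)}$ only (in particular without knowing $T$). Let $$\mathrm{OPT}=\min_{x_*^{(1)},\dots,x_*^{(T)}}\Big\|\sum_{t=1}^T C^{(t)}x_*^{(t)}\Big\| ,$$ where each $x_*^{(t)}$ ranges over the vectors in $\{0,1\}^k$ with exactly one entry $1$. The algorithm is $\beta$-competitive if $\|\sum_{t=1}^T C^{(t)}x^{(t)}\|\le\beta\cdot\mathrm{OPT}$ for all $T$ and all $C^{(1)},\dots,C^{(T)}$. The norm is *symmetric* if it is invariant under permutations of the coordinates, and *monotone* if $\|x\|\le\|y\|$ whenever $|x_i|\le|y_i|$ for all $i$. A *Ball-Optimization oracle*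 for the norm returns, for a query $x\in\mathbb{R}^m$, the number $\max_{v:\|v\|\le 1}\langle x,v\rangle$. Running times are measured on a random access machine over the reals: it has integer variables (addition, truncated subtraction, comparison), used for control and addressing, and arrays of real numbers (exact addition, subtraction, multiplication, division, comparison, rational constants), and each elementary operation and each oracle call takes one step. There is no rounding operation. The program is given $m$ and $k$ at the start, is run once per arriving job, and keeps its memory between jobs. **Theorem.** There are a constant $C$, a single program $P$ and a polynomial $p$ such that for all $m\ge 2$ and $k\ge 1$ and every monotone symmetric norm $\|\cdot\|$ on $\mathbb{R}^m$ the following holds. There is a deterministic online algorithm for Online Generalized Load Balancing with the norm $\|\cdot\|$ that is $(C\log^2 m)$-competitive, and this algorithm is carried out by $P$ with access to a Ball-Optimization oracle for $\|\cdot\|$, where the selection for job $t$ takes at most $p(m\,k\,t)$ steps. -/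

import Mathlib

namespace OnlineLoadBalancing

/-! ### Norms and the Ball-Optimization oracle -/

/-- A monotone symmetric norm on `ℝ^m`: a definite seminorm that is monotone in the absolute
values of the coordinates and invariant under permutations of the coordinates. -/
structure IsMonotoneSymmetricNorm {m : ℕ} (N : Seminorm ℝ (Fin m → ℝ)) : Prop where
  definite : ∀ x, N x = 0 → x = 0
  monotone : ∀ x y, (∀ i, |x i| ≤ |y i|) → N x ≤ N y
  symmetric : ∀ (σ : Equiv.Perm (Fin m)) (x : Fin m → ℝ), N (x ∘ σ) = N x

/-- The answer of the Ball-Optimization oracle of the norm `N` to the query `x`: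
`max {⟨x, v⟩ : N v ≤ 1}`. -/
noncomputable def ballOpt {m : ℕ} (N : Seminorm ℝ (Fin m → ℝ)) (x : Fin m → ℝ) : ℝ :=
  sSup {r : ℝ | ∃ v : Fin m → ℝ, N v ≤ 1 ∧ r = ∑ i, x i * v i}

/-! ### The online problem

Job `t` (counted from `0`) is an `m × k` matrix whose column `j` is the vector of loads that the
machines incur if the job is processed with option `j`. An instance consists of a sequence of jobs
and the number `T` of jobs that arrive. -/

/-- A deterministic online algorithm: the option for job `t` is a function of the jobs
`0, …, t` only. In particular the number of jobs is not known to it. -/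
abbrev OnlineAlgorithm (m k : ℕ) : Type :=
  (t : ℕ) → (Fin (t + 1) → Matrix (Fin m) (Fin k) ℝ) → Fin k

/-- The option that `A` selects for job `t` of the sequence `J`. -/
def OnlineAlgorithm.choice {m k : ℕ} (A : OnlineAlgorithm m k)
    (J : ℕ → Matrix (Fin m) (Fin k) ℝ) (t : ℕ) : Fin k :=
  A t (fun s => J s)

/-- The total load vector when the jobs `0, …, T - 1` are processed with the options `x`. -/
def totalLoad {m k : ℕ} (J : ℕ → Matrix (Fin m) (Fin k) ℝ) (T : ℕ) (x : Fin T → Fin k) :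
    Fin m → ℝ :=
  fun i => ∑ t : Fin T, J t i (x t)

/-- The offline optimum for the jobs `0, …, T - 1`. For `1 ≤ k` this is a minimum over a finite
nonempty set. -/
noncomputable def OPT {m k : ℕ} (N : Seminorm ℝ (Fin m → ℝ))
    (J : ℕ → Matrix (Fin m) (Fin k) ℝ) (T : ℕ) : ℝ :=
  ⨅ x : Fin T → Fin k, N (totalLoad J T x)

/-- `A` is `β`-competitive for the norm `N`. -/
def IsCompetitive {m k : ℕ} (N : Seminorm ℝ (Fin m → ℝ)) (A : OnlineAlgorithm m k) (β : ℝ) :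
    Prop :=
  ∀ J : ℕ → Matrix (Fin m) (Fin k) ℝ, (∀ t i j, 0 ≤ J t i j) →
    ∀ T : ℕ, N (totalLoad J T (fun t => A.choice J t)) ≤ β * OPT N J T

/-! ### Random access machines over the reals with an oracle

A machine has integer variables (used for control and for addresses) and arrays of real
numbers. Integers can be added, subtracted and compared; reals can be added, subtracted,
multiplied, divided and compared. There is no rounding, no conversion between reals and integers,
and no multiplication of integers. Programs are finite and their constants are rational. -/

/-- The memory: `idx v` is the value of the integer variable `v`, and `real a i` is the entry at
position `i` of the real array `a`. -/
structure Memory where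
  idx : ℕ → ℕ
  real : ℕ → ℕ → ℝ

/-- Integer expressions; `sub` is truncated subtraction. -/
inductive IExpr where
  | const (n : ℕ)
  | var (v : ℕ)
  | add (e f : IExpr)
  | sub (e f : IExpr)

def IExpr.eval (s : Memory) : IExpr → ℕ
  | .const n => n
  | .var v => s.idx v
  | .add e f => e.eval s + f.eval s
  | .sub e f => e.eval s - f.eval s

/-- Real expressions; `read a e` is the entry of the array `a` at the position `e`. -/
inductive RExpr where
  | const (q : ℚ)
  | read (a : ℕ) (e : IExpr)
  | add (e f : RExpr)
  | sub (e f : RExpr)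
  | mul (e f : RExpr)
  | div (e f : RExpr)

noncomputable def RExpr.eval (s : Memory) : RExpr → ℝ
  | .const q => (q : ℝ)
  | .read a e => s.real a (e.eval s)
  | .add e f => e.eval s + f.eval s
  | .sub e f => e.eval s - f.eval s
  | .mul e f => e.eval s * f.eval s
  | .div e f => e.eval s / f.eval s

/-- Comparisons of two integers or of two reals. -/
inductive Comparison where
  | int (e f : IExpr)
  | real (e f : RExpr)

def Comparison.Holds (s : Memory) : Comparison → Prop
  | .int e f => e.eval s ≤ f.eval s
  | .real e f => e.eval s ≤ f.eval s

/-- Programs. `setInt v e` assigns `e` to the integer variable `v`; `setReal a e r` writes `r` at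
position `e` of the array `a`; `query a b e` asks the oracle about the vector stored in the first
`m` entries of the array `a` and writes the answer at position `e` of the array `b`. -/
inductive Program where
  | setInt (v : ℕ) (e : IExpr)
  | setReal (a : ℕ) (e : IExpr) (r : RExpr)
  | query (a b : ℕ) (e : IExpr)
  | seq (P Q : Program)
  | ite (c : Comparison) (P Q : Program)
  | loop (c : Comparison) (P : Program)

def Memory.writeInt (s : Memory) (v n : ℕ) : Memory :=
  { s with idx := Function.update s.idx v n }

noncomputable def Memory.writeReal (s : Memory) (a i : ℕ) (r : ℝ) : Memory :=
  { s with real := Function.update s.real a (Function.update (s.real a) i r) }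

open Classical in
/-- One step of the machine with oracle `O`. A configuration is the list of the programs that are
still to be executed, together with the memory; the machine has halted when the list is empty.
Each assignment, each oracle call, each evaluation of a branching or loop condition and each
unfolding of a composition is one step. -/
noncomputable def step {m : ℕ} (O : (Fin m → ℝ) → ℝ) :
    List Program × Memory → List Program × Memory
  | ([], s) => ([], s)
  | (.setInt v e :: K, s) => (K, s.writeInt v (e.eval s))
  | (.setReal a e r :: K, s) => (K, s.writeReal a (e.eval s) (r.eval s))
  | (.query a b e :: K, s) => (K, s.writeReal b (e.eval s) (O (fun i => s.real a i)))
  | (.seq P Q :: K, s) => (P :: Q :: K, s)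
  | (.ite c P Q :: K, s) => ((if c.Holds s then P else Q) :: K, s)
  | (.loop c P :: K, s) => if c.Holds s then (P :: .loop c P :: K, s) else (K, s)

/-- Started with memory `s`, the program `P` halts after at most `n` steps, with memory `s'`. -/
def HaltsWithin {m : ℕ} (O : (Fin m → ℝ) → ℝ) (P : Program) (s : Memory) (n : ℕ)
    (s' : Memory) : Prop :=
  (step O)^[n] ([P], s) = ([], s')

/-- The memory before the first job: `m` and `k` are in the integer variables `0` and `1`;
everything else is zero. -/
def startMemory (m k : ℕ) : Memory where
  idx := fun v => if v = 0 then m else if v = 1 then k else 0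
  real := fun _ _ => 0

/-- The arrival of a job: its matrix is written into the array `0`, column after column. The rest
of the memory is unchanged. -/
noncomputable def Memory.receive {m k : ℕ} (s : Memory) (M : Matrix (Fin m) (Fin k) ℝ) : Memory :=
  { s with real := Function.update s.real 0 (fun p =>
      if h : p % m < m ∧ p / m < k then M ⟨p % m, h.1⟩ ⟨p / m, h.2⟩ else 0) }

/-- The program `P`, with oracle `O`, carries out the online algorithm `A` with at most `time t`
steps for job `t`: `P` is run once for each arriving job, on the memory that its previous run
left, and it has to leave the selected option in the integer variable `2`. -/
def Computes {m k : ℕ} (O : (Fin m → ℝ) → ℝ) (P : Program) (A : OnlineAlgorithm m k)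
    (time : ℕ → ℕ) : Prop :=
  ∀ J : ℕ → Matrix (Fin m) (Fin k) ℝ, (∀ t i j, 0 ≤ J t i j) →
    ∃ s : ℕ → Memory, s 0 = startMemory m k ∧
      ∀ t : ℕ, HaltsWithin O P ((s t).receive (J t)) (time t) (s (t + 1)) ∧
        (s (t + 1)).idx 2 = (A.choice J t : ℕ)

end OnlineLoadBalancing

/-!
Only the norms of the indicator vectors of `2 ^ r` machines matter, for the `L ≤ 3 log m` values of
`r` with `2 ^ r ≤ m`. The dual norm of such an indicator is one answer of the oracle, and by
averaging over permutations it determines the norm of the indicator (`norm_ind_le_weight`,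
`weight_mul_sum_le`); call this norm `w r`. A vector of norm `1` has, for every `r`, its `2 ^ r`
largest entries of mean at most `1 / w r`. Conversely, if for every `r` fewer than `2 ^ r` entries
exceed `c / w r`, then the vector is dominated by `L` multiples of indicators and has norm at most
`2 c L`. So it suffices to keep these thresholds with `c` of order `L`.

This is done by a greedy algorithm with the potential `∑ r, 2⁻ʳ ∑ i, φ (w r * y i / λ)`, where `λ`
is a guess of the optimum up to a constant. The penalty `φ` grows exponentially from `2⁻ᴸ` at `0` to
`1` at `L`, so that the initial potential is bounded, and then linearly with slope `1`. Since `φ` is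
convex, the potential is supermodular, and the load `y` that the greedy choices build up satisfies
`2 pot y ≤ pot 0 + pot (y + z)` against the load `z` of any other solution for the same jobs
(`greedy_step`). If `z` has norm at most `λ / 4`, its entries below the threshold cost a factor
`4 / 3` because `φ' ≤ φ`, and those above it cost at most `1 / 4` per level because `φ' ≤ 1`
(`pot_add_le`). Hence `pot y ≤ 2 L`, and a potential of at most `2 L` forces `c ≤ 3 L`, i.e. a norm
of at most `6 L² λ` (`norm_le_of_pot_le`).

When the potential exceeds `2 L`, the guess `λ` was below four times the optimum. Then `λ` is
doubled, or raised to an estimate of the cheapest option of the current job, and a new phase with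
load `0` begins. The loads of the phases form a geometric sum (`Invariant`). As the estimate is
correct up to a factor of order `m`, a job causes at most `L + 2` new phases (`pot_greedy_le`),
which bounds the running time although nothing is known about the size of the numbers. An option
without load is always taken, so `λ = 0` never enters a division that matters.

The program is composed of loops whose effect is described by Hoare triples for total correctness
with a step count (`Run`). A fragment with base `b` leaves all variables and arrays below `b`
unchanged (`Agree`), which lets fragments be nested. The online algorithm is defined as what the
program outputs.
-/

namespace OnlineLoadBalancing

/-! ### Sums and indicators under a symmetric norm -/

section Norm

variable {m : ℕ} {N : Seminorm ℝ (Fin m → ℝ)}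

/-- The indicator vector of a set of machines. -/
def ind (T : Finset (Fin m)) : Fin m → ℝ := fun i => if i ∈ T then 1 else 0

/-- The first `k` machines. -/
def initSeg (m k : ℕ) : Finset (Fin m) := Finset.univ.filter fun i => (i : ℕ) < k

theorem card_initSeg {k : ℕ} (hk : k ≤ m) : (initSeg m k).card = k := by
  simp [initSeg, Fin.card_filter_val_lt, hk]

theorem ind_nonneg (T : Finset (Fin m)) (i : Fin m) : 0 ≤ ind T i := by
  unfold ind; split_ifs <;> norm_num

theorem sum_ind_mul (T : Finset (Fin m)) (v : Fin m → ℝ) :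
    ∑ i, ind T i * v i = ∑ i ∈ T, v i := by
  simp [ind, Finset.sum_ite_mem]

theorem norm_le_of_nonneg_le (hN : IsMonotoneSymmetricNorm N) {x y : Fin m → ℝ}
    (h0 : ∀ i, 0 ≤ x i) (h : ∀ i, x i ≤ y i) : N x ≤ N y :=
  hN.monotone x y fun i => by
    rw [abs_of_nonneg (h0 i), abs_of_nonneg ((h0 i).trans (h i))]; exact h i

theorem norm_ind_mono (hN : IsMonotoneSymmetricNorm N) {S T : Finset (Fin m)} (h : S ⊆ T) :
    N (ind S) ≤ N (ind T) := by
  refine norm_le_of_nonneg_le hN (ind_nonneg S) fun i => ?_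
  unfold ind
  by_cases hS : i ∈ S
  · simp [hS, h hS]
  · simp only [hS, if_false]; split_ifs <;> norm_num

theorem norm_ind_pos (hN : IsMonotoneSymmetricNorm N) {T : Finset (Fin m)} (hT : T.Nonempty) :
    0 < N (ind T) := by
  obtain ⟨i, hi⟩ := hT
  refine lt_of_le_of_ne (apply_nonneg N _) fun h => ?_
  have := congrFun (hN.definite _ h.symm) i
  simp [ind, hi] at this

/-- Two sets of the same size differ by a permutation of the machines. -/
theorem exists_perm_of_card_eq {S T : Finset (Fin m)} (h : S.card = T.card) :
    ∃ σ : Equiv.Perm (Fin m), ∀ i, σ i ∈ T ↔ i ∈ S := by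
  classical
  have e : {x // x ∈ S} ≃ {x // x ∈ T} := Fintype.equivOfCardEq (by simpa using h)
  refine ⟨e.extendSubtype, fun i => ⟨fun hi => ?_, fun hi => e.extendSubtype_mem i hi⟩⟩
  by_contra hn
  exact e.extendSubtype_not_mem i hn hi

theorem norm_ind_congr (hN : IsMonotoneSymmetricNorm N) {S T : Finset (Fin m)}
    (h : S.card = T.card) : N (ind S) = N (ind T) := by
  obtain ⟨σ, hσ⟩ := exists_perm_of_card_eq h
  rw [← hN.symmetric σ (ind T)]
  congr 1
  funext i
  simp [ind, hσ]

theorem bddAbove_ballOpt (hN : IsMonotoneSymmetricNorm N) (x : Fin m → ℝ) :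
    BddAbove {r : ℝ | ∃ v : Fin m → ℝ, N v ≤ 1 ∧ r = ∑ i, x i * v i} := by
  refine ⟨∑ i, |x i| * (N (ind {i}))⁻¹, ?_⟩
  rintro r ⟨v, hv, rfl⟩
  refine Finset.sum_le_sum fun i _ => ?_
  have hp : 0 < N (ind {i}) := norm_ind_pos hN (Finset.singleton_nonempty i)
  have h1 : |v i| * N (ind {i}) ≤ 1 := by
    have h2 : N (v i • ind {i}) ≤ N v := by
      refine hN.monotone _ _ fun l => ?_
      by_cases hl : l = i
      · simp [ind, hl]
      · simp [ind, hl]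
    rw [map_smul_eq_mul, Real.norm_eq_abs] at h2
    exact h2.trans hv
  have h3 : |v i| ≤ (N (ind {i}))⁻¹ := by
    rw [← one_div, le_div_iff₀ hp]; exact h1
  calc x i * v i ≤ |x i * v i| := le_abs_self _
    _ = |x i| * |v i| := abs_mul _ _
    _ ≤ _ := mul_le_mul_of_nonneg_left h3 (abs_nonneg _)

/-- The inequality between a norm and its dual norm. -/
theorem sum_mul_le_ballOpt (hN : IsMonotoneSymmetricNorm N) (x v : Fin m → ℝ) :
    ∑ i, x i * v i ≤ ballOpt N x * N v := by
  rcases eq_or_ne (N v) 0 with h | h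
  · simp [hN.definite v h]
  · have hp : 0 < N v := lt_of_le_of_ne (apply_nonneg N v) h.symm
    have h1 : ∑ i, x i * ((N v)⁻¹ • v) i ≤ ballOpt N x := by
      refine le_csSup (bddAbove_ballOpt hN x) ⟨(N v)⁻¹ • v, ?_, rfl⟩
      rw [map_smul_eq_mul, Real.norm_eq_abs, abs_of_pos (inv_pos.mpr hp), inv_mul_cancel₀ h]
    have h2 : ∑ i, x i * ((N v)⁻¹ • v) i = (∑ i, x i * v i) / N v := by
      rw [Finset.sum_div]
      refine Finset.sum_congr rfl fun i _ => ?_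
      simp only [Pi.smul_apply, smul_eq_mul]; field_simp
    rw [h2, div_le_iff₀ hp] at h1
    exact h1

/-- Averaging `v` over all permutations that preserve `T` gives a vector which is constant on `T`,
so the norm of the indicator of `T` is controlled by the mean of `v` on `T`. -/
theorem sum_mul_norm_ind_le (hN : IsMonotoneSymmetricNorm N) (T : Finset (Fin m))
    (v : Fin m → ℝ) : (∑ i ∈ T, v i) * N (ind T) ≤ T.card * N v := by
  classical
  set G : Finset (Equiv.Perm (Fin m)) := Finset.univ.filter fun σ => ∀ i, σ i ∈ T ↔ i ∈ T with hG
  have h1G : (1 : Equiv.Perm (Fin m)) ∈ G := by simp [hG]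
  have hcG : (0 : ℝ) < G.card := by exact_mod_cast Finset.card_pos.mpr ⟨_, h1G⟩
  set c : Fin m → ℝ := ∑ σ ∈ G, v ∘ σ with hc
  have hcN : N c ≤ G.card * N v := by
    refine (Finset.le_sum_of_subadditive N (map_zero N).le (map_add_le_add N) G
      fun σ => v ∘ σ).trans ?_
    rw [Finset.sum_congr rfl fun σ _ => hN.symmetric σ v]
    simp
  have hci : ∀ i, c i = ∑ σ ∈ G, v (σ i) := fun i => by simp [hc, Finset.sum_apply]
  have hconst : ∀ i ∈ T, ∀ j ∈ T, c i = c j := by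
    intro i hi j hj
    rw [hci, hci]
    refine Finset.sum_bij' (fun σ _ => σ * Equiv.swap i j) (fun σ _ => σ * Equiv.swap i j)
      ?_ ?_ ?_ ?_ ?_
    · intro σ hσ
      simp only [hG, Finset.mem_filter, Finset.mem_univ, true_and] at hσ ⊢
      intro l
      rw [Equiv.Perm.mul_apply, hσ]
      rcases eq_or_ne l i with rfl | h1
      · simp [hi, hj]
      rcases eq_or_ne l j with rfl | h2
      · simp [hi, hj]
      rw [Equiv.swap_apply_of_ne_of_ne h1 h2]
    · intro σ hσ
      simp only [hG, Finset.mem_filter, Finset.mem_univ, true_and] at hσ ⊢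
      intro l
      rw [Equiv.Perm.mul_apply, hσ]
      rcases eq_or_ne l i with rfl | h1
      · simp [hi, hj]
      rcases eq_or_ne l j with rfl | h2
      · simp [hi, hj]
      rw [Equiv.swap_apply_of_ne_of_ne h1 h2]
    · intro σ _; simp [mul_assoc]
    · intro σ _; simp [mul_assoc]
    · intro σ _; simp
  have hsum : ∑ i ∈ T, c i = G.card * ∑ i ∈ T, v i := by
    simp only [hci]
    rw [Finset.sum_comm]
    rw [Finset.sum_congr rfl (g := fun _ => ∑ i ∈ T, v i), Finset.sum_const, nsmul_eq_mul]
    intro σ hσ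
    simp only [hG, Finset.mem_filter, Finset.mem_univ, true_and] at hσ
    exact Finset.sum_equiv σ (fun i => (hσ i).symm) fun _ _ => rfl
  have hle : (G.card * ∑ i ∈ T, v i) * N (ind T) ≤ T.card * N c := by
    rcases T.eq_empty_or_nonempty with rfl | ⟨i₀, hi₀⟩
    · simp
    · have h1 : ∑ i ∈ T, c i = T.card * c i₀ := by
        rw [Finset.sum_congr rfl fun i hi => hconst i hi i₀ hi₀]; simp
      have h2 : N (c i₀ • ind T) ≤ N c := by
        refine hN.monotone _ _ fun i => ?_
        by_cases hi : i ∈ T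
        · simp [ind, hi, hconst i hi i₀ hi₀]
        · simp [ind, hi]
      rw [map_smul_eq_mul, Real.norm_eq_abs] at h2
      rw [← hsum, h1, mul_assoc]
      refine mul_le_mul_of_nonneg_left (le_trans ?_ h2) (Nat.cast_nonneg _)
      exact mul_le_mul_of_nonneg_right (le_abs_self _) (apply_nonneg N _)
  have h4 : G.card * ((∑ i ∈ T, v i) * N (ind T)) ≤ G.card * (T.card * N v) := by
    calc _ = (G.card * ∑ i ∈ T, v i) * N (ind T) := by ring
      _ ≤ T.card * N c := hle
      _ ≤ T.card * (G.card * N v) := mul_le_mul_of_nonneg_left hcN (Nat.cast_nonneg _)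
      _ = _ := by ring
  exact le_of_mul_le_mul_left h4 hcG

/-- The reciprocal, up to the factor `k`, of the dual norm of the indicator of `k` machines. It
equals the norm of that indicator, and it is computed with one call of the oracle. -/
noncomputable def weight (N : Seminorm ℝ (Fin m → ℝ)) (k : ℕ) : ℝ :=
  k / ballOpt N (ind (initSeg m k))

theorem ballOpt_ind_pos (hN : IsMonotoneSymmetricNorm N) {k : ℕ} (h1 : 1 ≤ k) (hk : k ≤ m) :
    0 < ballOpt N (ind (initSeg m k)) := by
  have hne : (initSeg m k).Nonempty := Finset.card_pos.mp (by rw [card_initSeg hk]; omega)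
  have h := sum_mul_le_ballOpt hN (ind (initSeg m k)) (ind (initSeg m k))
  rw [sum_ind_mul] at h
  have h2 : ∑ i ∈ initSeg m k, ind (initSeg m k) i = k := by
    rw [Finset.sum_congr rfl (g := fun _ => (1 : ℝ))]
    · simp [card_initSeg hk]
    · intro i hi; simp [ind, hi]
  rw [h2] at h
  have h3 : (0 : ℝ) < k := by exact_mod_cast h1
  exact pos_of_mul_pos_left (h3.trans_le h) (apply_nonneg N _)

theorem weight_pos (hN : IsMonotoneSymmetricNorm N) {k : ℕ} (h1 : 1 ≤ k) (hk : k ≤ m) :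
    0 < weight N k :=
  div_pos (by exact_mod_cast h1) (ballOpt_ind_pos hN h1 hk)

/-- The `k` largest entries of `v` have mean at most `N v / weight N k`. -/
theorem weight_mul_sum_le (hN : IsMonotoneSymmetricNorm N) {k : ℕ} (h1 : 1 ≤ k) (hk : k ≤ m)
    {T : Finset (Fin m)} (hT : T.card ≤ k) {v : Fin m → ℝ} (hv : ∀ i, 0 ≤ v i) :
    weight N k * ∑ i ∈ T, v i ≤ k * N v := by
  have hpos := ballOpt_ind_pos hN h1 hk
  obtain ⟨T', hTT', hT'⟩ := Finset.exists_superset_card_eq hT (by simpa using hk)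
  obtain ⟨σ, hσ⟩ := exists_perm_of_card_eq (S := initSeg m k) (T := T')
    (by rw [card_initSeg hk, hT'])
  have h := sum_mul_le_ballOpt hN (ind (initSeg m k)) (v ∘ σ)
  rw [sum_ind_mul, hN.symmetric] at h
  have h2 : ∑ i ∈ initSeg m k, (v ∘ σ) i = ∑ i ∈ T', v i :=
    Finset.sum_equiv σ (fun i => (hσ i).symm) fun _ _ => rfl
  have h3 : ∑ i ∈ T, v i ≤ ∑ i ∈ T', v i :=
    Finset.sum_le_sum_of_subset_of_nonneg hTT' fun i _ _ => hv i
  rw [weight, div_mul_eq_mul_div, div_le_iff₀ hpos, mul_assoc]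
  refine mul_le_mul_of_nonneg_left ?_ (Nat.cast_nonneg _)
  calc _ ≤ _ := h3
    _ = _ := h2.symm
    _ ≤ _ := h
    _ = _ := mul_comm _ _

theorem norm_ind_le_weight (hN : IsMonotoneSymmetricNorm N) {k : ℕ} (h1 : 1 ≤ k) (hk : k ≤ m)
    {T : Finset (Fin m)} (hT : T.card ≤ k) : N (ind T) ≤ weight N k := by
  obtain ⟨T', hTT', hT'⟩ := Finset.exists_superset_card_eq hT (by simpa using hk)
  refine (norm_ind_mono hN hTT').trans ?_
  rw [norm_ind_congr hN (T := initSeg m k) (by rw [card_initSeg hk, hT'])]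
  have hne : (initSeg m k).Nonempty := Finset.card_pos.mp (by rw [card_initSeg hk]; omega)
  have hp := norm_ind_pos hN hne
  rw [weight, le_div_iff₀ (ballOpt_ind_pos hN h1 hk), mul_comm, ← le_div_iff₀ hp]
  refine csSup_le ⟨0, 0, by simp, by simp⟩ ?_
  rintro r ⟨v, hv, rfl⟩
  rw [sum_ind_mul, le_div_iff₀ hp]
  refine (sum_mul_norm_ind_le hN _ v).trans ?_
  rw [card_initSeg hk]
  simpa using mul_le_mul_of_nonneg_left hv (Nat.cast_nonneg (α := ℝ) k)

/-- A set of at most `2 * k` machines is the union of two sets of at most `k` machines. -/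
theorem norm_ind_le_two_mul_weight (hN : IsMonotoneSymmetricNorm N) {k : ℕ} (h1 : 1 ≤ k)
    (hk : k ≤ m) {T : Finset (Fin m)} (hT : T.card ≤ 2 * k) : N (ind T) ≤ 2 * weight N k := by
  classical
  by_cases hc : T.card ≤ k
  · have := norm_ind_le_weight hN h1 hk hc
    have := weight_pos hN h1 hk
    linarith
  · obtain ⟨S, hST, hS⟩ := Finset.exists_subset_card_eq (s := T) (n := k) (by omega)
    have hd : (T \ S).card ≤ k := by rw [Finset.card_sdiff_of_subset hST]; omega
    have he : ind T = ind S + ind (T \ S) := by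
      funext i
      by_cases hi : i ∈ S
      · simp [ind, hi, hST hi]
      · simp [ind, hi]
    rw [he, two_mul]
    exact (map_add_le_add N _ _).trans
      (add_le_add (norm_ind_le_weight hN h1 hk hS.le) (norm_ind_le_weight hN h1 hk hd))

theorem norm_le_weight_one_mul_sum (hN : IsMonotoneSymmetricNorm N) (hm : 1 ≤ m)
    {x : Fin m → ℝ} (hx : ∀ i, 0 ≤ x i) : N x ≤ weight N 1 * ∑ i, x i := by
  have he : x = ∑ i, x i • ind {i} := by
    funext l
    simp [ind, Finset.sum_apply]
  conv_lhs => rw [he]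
  refine (Finset.le_sum_of_subadditive N (map_zero N).le (map_add_le_add N) _ _).trans ?_
  rw [Finset.mul_sum]
  refine Finset.sum_le_sum fun i _ => ?_
  rw [map_smul_eq_mul, Real.norm_eq_abs, abs_of_nonneg (hx i), mul_comm]
  exact mul_le_mul_of_nonneg_right (norm_ind_le_weight hN le_rfl hm (by simp)) (hx i)

/-- In a vector of norm at most `c`, fewer than `k` entries exceed the threshold `c / weight N k`,
and the excess over it has a small sum. -/
theorem sum_excess_le (hN : IsMonotoneSymmetricNorm N) {k : ℕ} (h1 : 1 ≤ k) (hk : k ≤ m)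
    {y : Fin m → ℝ} (hy : ∀ i, 0 ≤ y i) {c : ℝ} (hc : N y ≤ c) :
    ∑ i, max (weight N k * y i - c) 0 ≤ k * c := by
  classical
  have hc0 : 0 ≤ c := (apply_nonneg N y).trans hc
  set S : Finset (Fin m) := Finset.univ.filter fun i => c < weight N k * y i with hS
  have hcard : S.card ≤ k := by
    by_contra hlt
    obtain ⟨T, hTS, hT⟩ := Finset.exists_subset_card_eq (s := S) (n := k) (by omega)
    have hle := weight_mul_sum_le hN h1 hk hT.le hy
    have hne : T.Nonempty := Finset.card_pos.mp (by omega)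
    have hlt2 : ∑ i ∈ T, c < ∑ i ∈ T, weight N k * y i :=
      Finset.sum_lt_sum_of_nonempty hne fun i hi => by
        have := hTS hi
        simpa [hS] using this
    rw [← Finset.mul_sum, Finset.sum_const, hT, nsmul_eq_mul] at hlt2
    have : (k : ℝ) * N y ≤ k * c := mul_le_mul_of_nonneg_left hc (Nat.cast_nonneg _)
    linarith
  have hsplit : ∑ i, max (weight N k * y i - c) 0 = ∑ i ∈ S, (weight N k * y i - c) := by
    rw [hS, Finset.sum_filter]
    refine Finset.sum_congr rfl fun i _ => ?_
    split_ifs with h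
    · exact max_eq_left (by linarith)
    · exact max_eq_right (by linarith)
  rw [hsplit]
  calc ∑ i ∈ S, (weight N k * y i - c) ≤ ∑ i ∈ S, weight N k * y i :=
        Finset.sum_le_sum fun i _ => by linarith
    _ = weight N k * ∑ i ∈ S, y i := by rw [Finset.mul_sum]
    _ ≤ k * N y := weight_mul_sum_le hN h1 hk hcard hy
    _ ≤ k * c := mul_le_mul_of_nonneg_left hc (Nat.cast_nonneg _)

end Norm

/-! ### The penalty function -/

/-- The penalty for one load. On `[0, L]` it grows exponentially, from `2⁻ᴸ` to `1`, and from `L` on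
it is affine with slope `1`. A polynomial of degree `L` replaces the exponential function, which the
machine cannot evaluate. -/
noncomputable def phi (L : ℕ) (u : ℝ) : ℝ :=
  ((1 + min u L / L) / 2) ^ L + max (u - L) 0

theorem phi_zero (L : ℕ) : phi L 0 = (1 / 2) ^ L := by
  simp [phi]

theorem sub_le_phi {L : ℕ} {u : ℝ} (hu : 0 ≤ u) : u - L ≤ phi L u := by
  have h : 0 ≤ min u L / L := div_nonneg (le_min hu (Nat.cast_nonneg _)) (Nat.cast_nonneg _)
  have : 0 ≤ ((1 + min u L / L) / 2) ^ L := by positivity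
  unfold phi
  linarith [le_max_left (u - L) 0]

theorem phi_nonneg {L : ℕ} {u : ℝ} (hu : 0 ≤ u) : 0 ≤ phi L u := by
  have h : 0 ≤ min u L / L := div_nonneg (le_min hu (Nat.cast_nonneg _)) (Nat.cast_nonneg _)
  unfold phi
  positivity

theorem phi_mono {L : ℕ} {u v : ℝ} (hu : 0 ≤ u) (huv : u ≤ v) : phi L u ≤ phi L v := by
  have h : 0 ≤ min u L / L := div_nonneg (le_min hu (Nat.cast_nonneg _)) (Nat.cast_nonneg _)
  unfold phi
  gcongr

/-- The exponential part of `phi` has slope less than `1` on `[0, L]`. -/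
theorem pow_sub_pow_le_mul_sub {a b : ℝ} (ha : 0 ≤ a) (hab : a ≤ b) (hb : b ≤ 1) (n : ℕ) :
    b ^ n - a ^ n ≤ n * (b - a) := by
  induction n with
  | zero => simp
  | succ n ih =>
    have h1 : b ^ n ≤ 1 := pow_le_one₀ (ha.trans hab) hb
    have h2 : (b ^ n - a ^ n) * a ≤ n * (b - a) * 1 :=
      mul_le_mul ih (hab.trans hb) ha (mul_nonneg (Nat.cast_nonneg _) (by linarith))
    have h3 : b ^ n * (b - a) ≤ 1 * (b - a) := mul_le_mul_of_nonneg_right h1 (by linarith)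
    push_cast
    rw [pow_succ, pow_succ]
    linarith

section

variable {L : ℕ}

theorem expPart_sub_le (hL : 1 ≤ L) {a b : ℝ} (ha : 0 ≤ a) (hab : a ≤ b) (hb : b ≤ L) :
    ((1 + b / L) / 2) ^ L - ((1 + a / L) / 2) ^ L ≤ b - a := by
  have hL0 : (0 : ℝ) < L := by exact_mod_cast hL
  have h := pow_sub_pow_le_mul_sub (a := (1 + a / L) / 2) (b := (1 + b / L) / 2) (by positivity)
    (by gcongr) (by have := (div_le_one hL0).mpr hb; linarith) L
  have he : (L : ℝ) * ((1 + b / L) / 2 - (1 + a / L) / 2) = (b - a) / 2 := by field_simp; ring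
  linarith

theorem phi_eq (u : ℝ) :
    phi L u = ((1 + min u L / L) / 2) ^ L - min u L + u := by
  unfold phi
  have : max (u - L) 0 = u - min u L := by
    rcases le_total u L with h | h
    · rw [min_eq_left h, max_eq_right (by linarith)]; ring
    · rw [min_eq_right h, max_eq_left (by linarith)]
  rw [this]; ring

theorem phi_add_le (hL : 1 ≤ L) {u b : ℝ} (hu : 0 ≤ u) (hb : 0 ≤ b) :
    phi L (u + b) ≤ phi L u + b := by
  have h := expPart_sub_le hL (a := min u L) (b := min (u + b) L)
    (le_min hu (Nat.cast_nonneg _)) (min_le_min_right _ (by linarith)) (min_le_right _ _)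
  rw [phi_eq, phi_eq]
  linarith

/-- Since `phi' ≤ phi`, a small increment of the load changes the penalty by a small factor. -/
theorem one_sub_mul_phi_add_le (hL : 1 ≤ L) {u h : ℝ} (hu : 0 ≤ u) (h0 : 0 ≤ h) (h1 : h ≤ 1) :
    (1 - h) * phi L (u + h) ≤ phi L u := by
  have hL0 : (0 : ℝ) < L := by exact_mod_cast hL
  set a := min u (L : ℝ) with ha
  set b := min (u + h) (L : ℝ) with hb
  have ha0 : 0 ≤ a := le_min hu hL0.le
  have hab : a ≤ b := min_le_min_right _ (by linarith)
  have hbah : b - a ≤ h := by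
    rw [hb, ha]
    rcases le_total u L with h2 | h2
    · rw [min_eq_left h2]; linarith [min_le_left (u + h) (L : ℝ)]
    · rw [min_eq_right h2]; linarith [min_le_right (u + h) (L : ℝ)]
  have key : (1 - (b - a)) * ((1 + b / L) / 2) ^ L ≤ ((1 + a / L) / 2) ^ L := by
    have hd0 : 0 ≤ (b - a) / L := div_nonneg (by linarith) hL0.le
    have hd1 : (b - a) / L ≤ 1 := by
      rw [div_le_one hL0]
      have : (1 : ℝ) ≤ L := by exact_mod_cast hL
      linarith
    have hbern : 1 - (b - a) ≤ (1 - (b - a) / L) ^ L := by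
      have := one_add_mul_le_pow (a := -((b - a) / L)) (by linarith) L
      have he : (L : ℝ) * -((b - a) / L) = -(b - a) := by field_simp
      rw [he] at this
      calc _ = 1 + -(b - a) := by ring
        _ ≤ _ := this
        _ = _ := by ring
    have hb0 : 0 ≤ b / L := div_nonneg (ha0.trans hab) hL0.le
    calc _ ≤ (1 - (b - a) / L) ^ L * ((1 + b / L) / 2) ^ L :=
          mul_le_mul_of_nonneg_right hbern (by positivity)
      _ = ((1 - (b - a) / L) * ((1 + b / L) / 2)) ^ L := (mul_pow _ _ _).symm
      _ ≤ _ := by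
        refine pow_le_pow_left₀ (mul_nonneg (by linarith) (by positivity)) ?_ L
        have hsplit : b / L = a / L + (b - a) / L := by field_simp; ring
        have ha1 : 0 ≤ a / L := div_nonneg ha0 hL0.le
        rw [hsplit]
        nlinarith [mul_nonneg hd0 hd0, mul_nonneg ha1 hd0]
  have hq : 0 ≤ ((1 + b / L) / 2) ^ L := by
    have : 0 ≤ b / L := div_nonneg (ha0.trans hab) hL0.le
    positivity
  rw [phi_eq, phi_eq, ← ha, ← hb]
  have hua : a ≤ u := min_le_left _ _
  rcases le_total (u + h) L with h2 | h2
  · have e1 : b = u + h := min_eq_left h2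
    have e2 : a = u := min_eq_left (by linarith)
    have e3 : b - a = h := by rw [e1, e2]; ring
    rw [e3] at key
    rw [e1] at key hq ⊢
    rw [e2] at key ⊢
    linarith
  · -- Here the exponential part has reached its final value `1`.
    have e1 : b = L := min_eq_right h2
    have e2 : ((1 + b / L) / 2) ^ L = 1 := by rw [e1, div_self hL0.ne']; norm_num
    rw [e2] at key ⊢
    have h3 : 0 ≤ h * (u - a) := mul_nonneg h0 (by linarith)
    have h4 : 0 ≤ h * (h - (b - a)) := mul_nonneg h0 (by linarith)
    nlinarith

/-- `phi` is the infimal convolution of a convex function on `[0, L]` and the identity, hence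
convex. -/
theorem convexOn_phi (hL : 1 ≤ L) : ConvexOn ℝ (Set.Ici 0) (phi L) := by
  have hL0 : (0 : ℝ) < L := by exact_mod_cast hL
  refine ⟨convex_Ici 0, fun x hx y hy s t hs ht hst => ?_⟩
  simp only [Set.mem_Ici] at hx hy
  simp only [smul_eq_mul]
  set a := min x (L : ℝ) with ha
  set b := min y (L : ℝ) with hb
  have ha0 : 0 ≤ a := le_min hx hL0.le
  have hb0 : 0 ≤ b := le_min hy hL0.le
  have hc0 : 0 ≤ s * a + t * b := by positivity
  have hcL : s * a + t * b ≤ min (s * x + t * y) L := by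
    refine le_min (add_le_add ?_ ?_) ?_
    · exact mul_le_mul_of_nonneg_left (min_le_left _ _) hs
    · exact mul_le_mul_of_nonneg_left (min_le_left _ _) ht
    · calc s * a + t * b ≤ s * L + t * L :=
            add_le_add (mul_le_mul_of_nonneg_left (min_le_right _ _) hs)
              (mul_le_mul_of_nonneg_left (min_le_right _ _) ht)
        _ = L := by rw [← add_mul, hst, one_mul]
  have h1 := expPart_sub_le hL hc0 hcL (min_le_right _ _)
  have ha1 : 0 ≤ a / L := div_nonneg ha0 hL0.le
  have hb1 : 0 ≤ b / L := div_nonneg hb0 hL0.le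
  have h2 := (convexOn_pow L).2 (x := (1 + a / L) / 2) (y := (1 + b / L) / 2)
    (Set.mem_Ici.mpr (by positivity)) (Set.mem_Ici.mpr (by positivity)) hs ht hst
  simp only [smul_eq_mul] at h2
  have he : s * ((1 + a / L) / 2) + t * ((1 + b / L) / 2) = (1 + (s * a + t * b) / L) / 2 := by
    have : s = 1 - t := by linarith
    subst this; ring
  rw [he] at h2
  rw [phi_eq, phi_eq, phi_eq, ← ha, ← hb]
  linarith

/-- Increments of `phi` grow with the base point. -/
theorem phi_add_add_phi_le (hL : 1 ≤ L) {x y h : ℝ} (hx : 0 ≤ x) (hxy : x ≤ y) (hh : 0 ≤ h) :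
    phi L (x + h) + phi L y ≤ phi L x + phi L (y + h) := by
  rcases eq_or_lt_of_le (show x ≤ y + h by linarith) with he | hlt
  · have : h = 0 := by linarith
    subst this; simp
  · have hd : 0 < y + h - x := by linarith
    set t := h / (y + h - x) with ht
    have ht0 : 0 ≤ t := div_nonneg hh hd.le
    have ht1 : t ≤ 1 := by rw [ht, div_le_one hd]; linarith
    have hth : t * (y + h - x) = h := by rw [ht]; field_simp
    have hmx : x ∈ Set.Ici (0 : ℝ) := hx
    have hmy : y + h ∈ Set.Ici (0 : ℝ) := by simp only [Set.mem_Ici]; linarith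
    have h1 := (convexOn_phi hL).2 hmx hmy (by linarith : 0 ≤ 1 - t) ht0 (by ring)
    have h2 := (convexOn_phi hL).2 hmx hmy ht0 (by linarith : 0 ≤ 1 - t) (by ring)
    simp only [smul_eq_mul] at h1 h2
    rw [show (1 - t) * x + t * (y + h) = x + h by linarith] at h1
    rw [show t * x + (1 - t) * (y + h) = y by linarith] at h2
    linarith

end

/-! ### The potential -/

section Potential

variable {m : ℕ} {N : Seminorm ℝ (Fin m → ℝ)}

/-- The number of powers of two that are at most `m`. -/
def levels (m : ℕ) : ℕ := Nat.log 2 m + 1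

theorem two_pow_le_of_lt_levels (hm : 2 ≤ m) {r : ℕ} (hr : r < levels m) : 2 ^ r ≤ m :=
  Nat.pow_le_of_le_log (by omega) (Nat.lt_succ_iff.mp hr)

theorem lt_two_pow_levels (m : ℕ) : m < 2 ^ levels m :=
  Nat.lt_pow_succ_log_self (by norm_num) m

theorem two_le_levels (hm : 2 ≤ m) : 2 ≤ levels m := by
  have : 1 ≤ Nat.log 2 m := Nat.le_log_of_pow_le (by norm_num) (by simpa using hm)
  unfold levels; omega

/-- The potential of the load vector `y` at scale `lam`. The penalties at level `r` see whether
about `2 ^ r` machines have a load that is large for vectors of norm `lam`. -/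
noncomputable def pot (N : Seminorm ℝ (Fin m → ℝ)) (lam : ℝ) (y : Fin m → ℝ) : ℝ :=
  ∑ r ∈ Finset.range (levels m),
    (1 / 2) ^ r * ∑ i, phi (levels m) (weight N (2 ^ r) * y i / lam)

theorem scaled_nonneg (hN : IsMonotoneSymmetricNorm N) (hm : 2 ≤ m) {lam : ℝ} (hl : 0 < lam)
    {r : ℕ} (hr : r ∈ Finset.range (levels m)) {a : ℝ} (ha : 0 ≤ a) :
    0 ≤ weight N (2 ^ r) * a / lam :=
  div_nonneg (mul_nonneg (weight_pos hN Nat.one_le_two_pow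
    (two_pow_le_of_lt_levels hm (Finset.mem_range.mp hr))).le ha) hl.le

theorem pot_mono (hN : IsMonotoneSymmetricNorm N) (hm : 2 ≤ m) {lam : ℝ} (hl : 0 < lam)
    {x y : Fin m → ℝ} (hx : ∀ i, 0 ≤ x i) (hxy : ∀ i, x i ≤ y i) :
    pot N lam x ≤ pot N lam y := by
  refine Finset.sum_le_sum fun r hr => mul_le_mul_of_nonneg_left ?_ (by positivity)
  refine Finset.sum_le_sum fun i _ => phi_mono (scaled_nonneg hN hm hl hr (hx i)) ?_
  have hw := (weight_pos hN Nat.one_le_two_pow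
    (two_pow_le_of_lt_levels hm (Finset.mem_range.mp hr))).le
  exact div_le_div_of_nonneg_right (mul_le_mul_of_nonneg_left (hxy i) hw) hl.le

/-- The potential is supermodular. -/
theorem pot_add_add_pot_le (hN : IsMonotoneSymmetricNorm N) (hm : 2 ≤ m) {lam : ℝ} (hl : 0 < lam)
    {x y h : Fin m → ℝ} (hx : ∀ i, 0 ≤ x i) (hxy : ∀ i, x i ≤ y i) (hh : ∀ i, 0 ≤ h i) :
    pot N lam (x + h) + pot N lam y ≤ pot N lam x + pot N lam (y + h) := by
  unfold pot
  rw [← Finset.sum_add_distrib, ← Finset.sum_add_distrib]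
  refine Finset.sum_le_sum fun r hr => ?_
  rw [← mul_add, ← mul_add, ← Finset.sum_add_distrib, ← Finset.sum_add_distrib]
  refine mul_le_mul_of_nonneg_left (Finset.sum_le_sum fun i _ => ?_) (by positivity)
  have hw := (weight_pos hN Nat.one_le_two_pow
    (two_pow_le_of_lt_levels hm (Finset.mem_range.mp hr))).le
  have h2 := two_le_levels hm
  have := phi_add_add_phi_le (L := levels m) (by omega) (scaled_nonneg hN hm hl hr (hx i))
    (div_le_div_of_nonneg_right (mul_le_mul_of_nonneg_left (hxy i) hw) hl.le)
    (scaled_nonneg hN hm hl hr (hh i))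
  simpa only [Pi.add_apply, mul_add, add_div] using this

theorem pot_zero_le (lam : ℝ) : pot N lam 0 ≤ 2 := by
  have hmL : (m : ℝ) * (1 / 2) ^ levels m ≤ 1 := by
    have h : (m : ℝ) ≤ 2 ^ levels m := by exact_mod_cast (lt_two_pow_levels m).le
    rw [one_div, inv_pow, ← div_eq_mul_inv, div_le_one (by positivity)]
    exact h
  have hgeo : ∑ r ∈ Finset.range (levels m), (1 / 2 : ℝ) ^ r ≤ 2 := by
    rw [geom_sum_eq (by norm_num),
      show ∀ x : ℝ, (x - 1) / (1 / 2 - 1) = 2 * (1 - x) by intro x; ring]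
    have : (0 : ℝ) ≤ (1 / 2) ^ levels m := by positivity
    linarith
  calc pot N lam 0 = ∑ r ∈ Finset.range (levels m), (1 / 2 : ℝ) ^ r * (m * (1 / 2) ^ levels m) := by
        simp [pot, phi_zero]
    _ = (∑ r ∈ Finset.range (levels m), (1 / 2 : ℝ) ^ r) * (m * (1 / 2) ^ levels m) := by
        rw [Finset.sum_mul]
    _ ≤ 2 * 1 := mul_le_mul hgeo hmL (by positivity) (by norm_num)
    _ = 2 := by norm_num

/-- Adding a vector of small norm. At each level, the part of the vector below the threshold
multiplies the potential by at most `4 / 3`, and the part above it adds at most `1 / 4`. -/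
theorem pot_add_le (hN : IsMonotoneSymmetricNorm N) (hm : 2 ≤ m) {lam : ℝ} (hl : 0 < lam)
    {y z : Fin m → ℝ} (hy : ∀ i, 0 ≤ y i) (hz : ∀ i, 0 ≤ z i) (hz4 : 4 * N z ≤ lam) :
    pot N lam (y + z) ≤ 4 / 3 * pot N lam y + levels m / 4 := by
  have h2 := two_le_levels hm
  have hL : 1 ≤ levels m := by omega
  have hlev : ∀ r ∈ Finset.range (levels m),
      (1 / 2 : ℝ) ^ r * ∑ i, phi (levels m) (weight N (2 ^ r) * (y + z) i / lam) ≤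
        4 / 3 * ((1 / 2 : ℝ) ^ r * ∑ i, phi (levels m) (weight N (2 ^ r) * y i / lam)) + 1 / 4 := by
    intro r hr
    have hrm := two_pow_le_of_lt_levels hm (Finset.mem_range.mp hr)
    have hex := sum_excess_le hN Nat.one_le_two_pow hrm hz (c := lam / 4) (by linarith)
    have hi : ∀ i, phi (levels m) (weight N (2 ^ r) * (y + z) i / lam) ≤
        4 / 3 * phi (levels m) (weight N (2 ^ r) * y i / lam) +
          max (weight N (2 ^ r) * z i - lam / 4) 0 / lam := by
      intro i
      have hu := scaled_nonneg hN hm hl hr (hy i)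
      have hb : 0 ≤ max (weight N (2 ^ r) * z i - lam / 4) 0 / lam :=
        div_nonneg (le_max_right _ _) hl.le
      have hle : weight N (2 ^ r) * (y + z) i / lam ≤ weight N (2 ^ r) * y i / lam + 1 / 4 +
          max (weight N (2 ^ r) * z i - lam / 4) 0 / lam := by
        have h1 := le_max_left (weight N (2 ^ r) * z i - lam / 4) 0
        rw [show weight N (2 ^ r) * y i / lam + 1 / 4 +
          max (weight N (2 ^ r) * z i - lam / 4) 0 / lam = (weight N (2 ^ r) * y i + lam / 4 +
          max (weight N (2 ^ r) * z i - lam / 4) 0) / lam by field_simp]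
        refine div_le_div_of_nonneg_right ?_ hl.le
        rw [Pi.add_apply, mul_add]
        linarith
      have h3 := phi_mono (L := levels m)
        (scaled_nonneg hN hm hl hr (a := (y + z) i) (add_nonneg (hy i) (hz i))) hle
      have h4 := phi_add_le hL
        (by linarith : 0 ≤ weight N (2 ^ r) * y i / lam + 1 / 4) hb
      have h5 := one_sub_mul_phi_add_le hL hu (by norm_num : (0 : ℝ) ≤ 1 / 4) (by norm_num)
      linarith
    have hsum := Finset.sum_le_sum fun i (_ : i ∈ Finset.univ) => hi i
    rw [Finset.sum_add_distrib, ← Finset.mul_sum, ← Finset.sum_div] at hsum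
    have hex2 : (∑ i, max (weight N (2 ^ r) * z i - lam / 4) 0) / lam ≤ 2 ^ r / 4 := by
      rw [div_le_iff₀ hl]
      push_cast at hex
      linarith
    have hp : (0 : ℝ) < (1 / 2) ^ r := by positivity
    calc _ ≤ (1 / 2 : ℝ) ^ r * (4 / 3 * ∑ i, phi (levels m) (weight N (2 ^ r) * y i / lam) +
          2 ^ r / 4) := mul_le_mul_of_nonneg_left (by linarith) hp.le
      _ = _ := by
        have : (1 / 2 : ℝ) ^ r * 2 ^ r = 1 := by rw [← mul_pow]; norm_num
        linear_combination this / 4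
  refine (Finset.sum_le_sum hlev).trans ?_
  rw [Finset.sum_add_distrib, ← Finset.mul_sum]
  simp only [Finset.sum_const, Finset.card_range, nsmul_eq_mul, pot]
  linarith

/-- A load vector of small potential has fewer than `2 ^ r` entries above
`3 L lam / weight N (2 ^ r)` for each level `r`, and these thresholds, each on `2 ^ (r + 1)`
machines, add up to `6 L² lam`. -/
theorem norm_le_of_pot_le (hN : IsMonotoneSymmetricNorm N) (hm : 2 ≤ m) {lam : ℝ} (hl : 0 < lam)
    {y : Fin m → ℝ} (hy : ∀ i, 0 ≤ y i) (hpot : pot N lam y ≤ 2 * levels m) :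
    N y ≤ 6 * levels m ^ 2 * lam := by
  classical
  have h2 := two_le_levels hm
  set L := levels m with hLdef
  have hw : ∀ r < L, 0 < weight N (2 ^ r) := fun r hr =>
    weight_pos hN Nat.one_le_two_pow (two_pow_le_of_lt_levels hm hr)
  set S : ℕ → Finset (Fin m) := fun r =>
    Finset.univ.filter fun i => 3 * L * lam < weight N (2 ^ r) * y i with hS
  have hcard : ∀ r < L, (S r).card < 2 ^ r := by
    intro r hr
    by_contra hge
    push Not at hge
    have hnn : ∀ q ∈ Finset.range L,
        0 ≤ (1 / 2 : ℝ) ^ q * ∑ i, phi L (weight N (2 ^ q) * y i / lam) := fun q hq =>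
      mul_nonneg (by positivity)
        (Finset.sum_nonneg fun i _ => phi_nonneg (scaled_nonneg hN hm hl hq (hy i)))
    have h1 := (Finset.single_le_sum hnn (Finset.mem_range.mpr hr)).trans hpot
    have h3 : ∑ i ∈ S r, (2 * L : ℝ) < ∑ i ∈ S r, phi L (weight N (2 ^ r) * y i / lam) := by
      refine Finset.sum_lt_sum_of_nonempty
        (Finset.card_pos.mp (lt_of_lt_of_le (by positivity) hge)) fun i hi => ?_
      have hi2 : 3 * L * lam < weight N (2 ^ r) * y i := by simpa [hS] using hi
      have h4 : (3 * L : ℝ) < weight N (2 ^ r) * y i / lam := by rwa [lt_div_iff₀ hl]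
      have h5 := sub_le_phi (L := L) (scaled_nonneg hN hm hl (Finset.mem_range.mpr hr) (hy i))
      linarith
    have h6 : ∑ i ∈ S r, phi L (weight N (2 ^ r) * y i / lam) ≤
        ∑ i, phi L (weight N (2 ^ r) * y i / lam) :=
      Finset.sum_le_sum_of_subset_of_nonneg (Finset.subset_univ _) fun i _ _ =>
        phi_nonneg (scaled_nonneg hN hm hl (Finset.mem_range.mpr hr) (hy i))
    rw [Finset.sum_const, nsmul_eq_mul] at h3
    have h7 : (2 ^ r : ℝ) * (2 * L) ≤ (S r).card * (2 * L) :=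
      mul_le_mul_of_nonneg_right (by exact_mod_cast hge) (by positivity)
    have h8 : (2 ^ r : ℝ) * (2 * L) < ∑ i, phi L (weight N (2 ^ r) * y i / lam) := by linarith
    have h9 := mul_lt_mul_of_pos_left h8 (show (0 : ℝ) < (1 / 2) ^ r by positivity)
    have h10 : (1 / 2 : ℝ) ^ r * 2 ^ r = 1 := by rw [← mul_pow]; norm_num
    rw [← mul_assoc, h10, one_mul] at h9
    linarith
  set U : ℕ → Finset (Fin m) := fun r => if r + 1 < L then S (r + 1) else Finset.univ with hU
  have hUcard : ∀ r < L, (U r).card ≤ 2 * 2 ^ r := by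
    intro r hr
    simp only [hU]
    split_ifs with h
    · have := hcard (r + 1) h
      rw [pow_succ] at this
      omega
    · have hrL : r + 1 = L := by omega
      have := lt_two_pow_levels m
      rw [← hLdef, ← hrL, pow_succ] at this
      simp only [Finset.card_univ, Fintype.card_fin]
      omega
  set z : Fin m → ℝ := ∑ r ∈ Finset.range L, (3 * L * lam / weight N (2 ^ r)) • ind (U r) with hz
  have hzi : ∀ i, z i = ∑ r ∈ Finset.range L, 3 * L * lam / weight N (2 ^ r) * ind (U r) i :=
    fun i => by simp [hz, Finset.sum_apply]
  have hyz : ∀ i, y i ≤ z i := by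
    intro i
    -- The last level at which machine `i` is below the threshold pays for its load.
    set F := (Finset.range L).filter fun r => i ∉ S r with hF
    have h0 : S 0 = ∅ := Finset.card_eq_zero.mp (by have := hcard 0 (by omega); simpa using this)
    have hne : F.Nonempty :=
      ⟨0, by simp only [hF, Finset.mem_filter, Finset.mem_range, h0]; simp; omega⟩
    set r := F.max' hne with hr
    have hrF : r ∈ F := F.max'_mem hne
    have hrF2 : r < L ∧ i ∉ S r := by simpa [hF] using hrF
    have hiU : i ∈ U r := by
      simp only [hU]
      split_ifs with h
      · by_contra hn
        have : r + 1 ∈ F := by simp only [hF, Finset.mem_filter, Finset.mem_range]; exact ⟨h, hn⟩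
        have := F.le_max' _ this
        omega
      · simp
    have hle : y i ≤ 3 * L * lam / weight N (2 ^ r) := by
      have : ¬ 3 * L * lam < weight N (2 ^ r) * y i := by simpa [hS] using hrF2.2
      rw [le_div_iff₀ (hw r hrF2.1)]
      push Not at this
      linarith
    rw [hzi]
    have hnn : ∀ q ∈ Finset.range L, 0 ≤ 3 * L * lam / weight N (2 ^ q) * ind (U q) i :=
      fun q hq => mul_nonneg (div_nonneg (by positivity) (hw q (Finset.mem_range.mp hq)).le)
        (ind_nonneg _ _)
    refine le_trans ?_ (Finset.single_le_sum hnn (Finset.mem_range.mpr hrF2.1))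
    simpa [ind, hiU] using hle
  refine (norm_le_of_nonneg_le hN hy hyz).trans ?_
  refine (Finset.le_sum_of_subadditive N (map_zero N).le (map_add_le_add N) _ _).trans ?_
  have hterm : ∀ r ∈ Finset.range L,
      N ((3 * L * lam / weight N (2 ^ r)) • ind (U r)) ≤ 6 * L * lam := by
    intro r hr
    have hr' := Finset.mem_range.mp hr
    have hwr := hw r hr'
    have hn := norm_ind_le_two_mul_weight hN Nat.one_le_two_pow
      (two_pow_le_of_lt_levels hm hr') (hUcard r hr')
    have h0 : 0 ≤ 3 * L * lam / weight N (2 ^ r) := div_nonneg (by positivity) hwr.le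
    rw [map_smul_eq_mul, Real.norm_eq_abs, abs_of_nonneg h0]
    calc _ ≤ 3 * L * lam / weight N (2 ^ r) * (2 * weight N (2 ^ r)) :=
          mul_le_mul_of_nonneg_left hn h0
      _ = _ := by field_simp; ring
  refine (Finset.sum_le_sum hterm).trans ?_
  simp only [Finset.sum_const, Finset.card_range, nsmul_eq_mul]
  apply le_of_eq
  ring

end Potential

/-! ### The greedy algorithm with guessed scale -/

section Competitive

variable {m k : ℕ} {N : Seminorm ℝ (Fin m → ℝ)} {J : ℕ → Matrix (Fin m) (Fin k) ℝ}

/-- The load vector of the jobs `s, …, t - 1` with the options `x`. -/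
def load (J : ℕ → Matrix (Fin m) (Fin k) ℝ) (s t : ℕ) (x : ℕ → Fin k) : Fin m → ℝ :=
  fun i => ∑ r ∈ Finset.Ico s t, J r i (x r)

theorem load_self (s : ℕ) (x : ℕ → Fin k) : load J s s x = 0 := by
  funext i; simp [load]

theorem load_succ {s t : ℕ} (h : s ≤ t) (x : ℕ → Fin k) :
    load J s (t + 1) x = load J s t x + fun i => J t i (x t) := by
  funext i; simp [load, Finset.sum_Ico_succ_top h]

theorem zero_le_load (hJ : ∀ t i j, 0 ≤ J t i j) (s t : ℕ) (x : ℕ → Fin k) (i : Fin m) :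
    0 ≤ load J s t x i :=
  Finset.sum_nonneg fun r _ => hJ r i (x r)

theorem norm_load_mono (hN : IsMonotoneSymmetricNorm N) (hJ : ∀ t i j, 0 ≤ J t i j)
    {s s' t t' : ℕ} (hs : s' ≤ s) (ht : t ≤ t') (x : ℕ → Fin k) :
    N (load J s t x) ≤ N (load J s' t' x) :=
  norm_le_of_nonneg_le hN (zero_le_load hJ s t x) fun i =>
    Finset.sum_le_sum_of_subset_of_nonneg (Finset.Ico_subset_Ico hs ht) fun r _ _ => hJ r i (x r)

theorem totalLoad_eq_load (T : ℕ) (x : ℕ → Fin k) :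
    totalLoad J T (fun t => x t) = load J 0 T x := by
  funext i
  simp only [totalLoad, load, ← Finset.range_eq_Ico]
  exact Fin.sum_univ_eq_sum_range (fun r => J r i (x r)) T

theorem le_OPT (hk : 1 ≤ k) {T : ℕ} {c : ℝ} (h : ∀ x : ℕ → Fin k, c ≤ N (load J 0 T x)) :
    c ≤ OPT N J T := by
  have : Nonempty (Fin k) := ⟨⟨0, hk⟩⟩
  refine le_ciInf fun x => ?_
  have h1 := h fun s => if hs : s < T then x ⟨s, hs⟩ else ⟨0, hk⟩
  rw [← totalLoad_eq_load] at h1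
  simpa using h1

theorem OPT_le (T : ℕ) (x : ℕ → Fin k) : OPT N J T ≤ N (load J 0 T x) := by
  rw [← totalLoad_eq_load]
  exact ciInf_le (f := fun x : Fin T → Fin k => N (totalLoad J T x))
    ⟨0, by rintro _ ⟨x, rfl⟩; exact apply_nonneg N _⟩ _

theorem OPT_mono (hN : IsMonotoneSymmetricNorm N) (hJ : ∀ t i j, 0 ≤ J t i j) (hk : 1 ≤ k)
    (t : ℕ) : OPT N J t ≤ OPT N J (t + 1) :=
  le_OPT hk fun x => (OPT_le t x).trans (norm_load_mono hN hJ le_rfl (Nat.le_succ t) x)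

theorem OPT_nonneg (hk : 1 ≤ k) (t : ℕ) : 0 ≤ OPT N J t :=
  le_OPT hk fun _ => apply_nonneg N _

/-- The column of the option `j`. -/
def col (M : Matrix (Fin m) (Fin k) ℝ) (j : Fin k) : Fin m → ℝ := fun i => M i j

/-- An estimate of the norm of the column `j`, which is correct up to a factor of order `m`. -/
noncomputable def estimate (N : Seminorm ℝ (Fin m → ℝ)) (M : Matrix (Fin m) (Fin k) ℝ)
    (j : Fin k) : ℝ :=
  weight N 1 * (1 / 2) ^ (levels m - 1) * ∑ i, col M j i

/-- The option `j` is a greedy choice at scale `lam` and current load `Y`. -/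
def IsGreedy (N : Seminorm ℝ (Fin m → ℝ)) (M : Matrix (Fin m) (Fin k) ℝ) (lam : ℝ)
    (Y : Fin m → ℝ) (j : Fin k) : Prop :=
  ∀ j', pot N lam (Y + col M j) ≤ pot N lam (Y + col M j')

/-- The start of a new phase: the scale `lam` turns out to be too small for the job `M`, whose
cheapest option has the estimate `a`. The scale grows, and the load of the phase is reset. -/
def Bump (N : Seminorm ℝ (Fin m → ℝ)) (M : Matrix (Fin m) (Fin k) ℝ) (a : ℝ)
    (p q : ℝ × (Fin m → ℝ)) : Prop :=
  (p.1 < a ∨ ∃ j, IsGreedy N M p.1 p.2 j ∧ 2 * (levels m : ℝ) < pot N p.1 (p.2 + col M j)) ∧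
    q = (max (2 * p.1) a, 0)

/-- What the algorithm does with the job `M`. Its state is the scale and the load of the current
phase. An option without load is taken at once; otherwise new phases are started until the greedy
choice has a small potential. -/
def JobSpec (N : Seminorm ℝ (Fin m → ℝ)) (M : Matrix (Fin m) (Fin k) ℝ)
    (p q : ℝ × (Fin m → ℝ)) (j : Fin k) : Prop :=
  ∃ j₀, (∀ j', estimate N M j₀ ≤ estimate N M j') ∧
    ((estimate N M j₀ ≤ 0 ∧ j = j₀ ∧ q = p) ∨
     (0 < estimate N M j₀ ∧ ∃ p', Relation.ReflTransGen (Bump N M (estimate N M j₀)) p p' ∧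
        estimate N M j₀ ≤ p'.1 ∧ IsGreedy N M p'.1 p'.2 j ∧
        pot N p'.1 (p'.2 + col M j) ≤ 2 * levels m ∧ q = (p'.1, p'.2 + col M j)))

theorem estimate_le (hN : IsMonotoneSymmetricNorm N) (hm : 2 ≤ m)
    {M : Matrix (Fin m) (Fin k) ℝ} (hM : ∀ i j, 0 ≤ M i j) (j : Fin k) :
    estimate N M j ≤ 2 * N (col M j) := by
  have h1 : ∀ i, weight N 1 * col M j i ≤ N (col M j) := fun i => by
    simpa using weight_mul_sum_le hN le_rfl (by omega : 1 ≤ m) (T := {i}) (by simp)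
      (v := col M j) fun i => hM i j
  have h2 : weight N 1 * ∑ i, col M j i ≤ m * N (col M j) := by
    rw [Finset.mul_sum]
    simpa using Finset.sum_le_sum fun i (_ : i ∈ Finset.univ) => h1 i
  have h3 : (1 / 2 : ℝ) ^ (levels m - 1) * m ≤ 2 := by
    have h := lt_two_pow_levels m
    have he : levels m = levels m - 1 + 1 := by have := two_le_levels hm; omega
    rw [he, pow_succ] at h
    have h' : (m : ℝ) ≤ 2 ^ (levels m - 1) * 2 := by exact_mod_cast h.le
    rw [one_div, inv_pow, inv_mul_eq_div, div_le_iff₀ (by positivity)]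
    linarith
  calc estimate N M j = (1 / 2) ^ (levels m - 1) * (weight N 1 * ∑ i, col M j i) := by
        rw [estimate]; ring
    _ ≤ (1 / 2) ^ (levels m - 1) * (m * N (col M j)) :=
        mul_le_mul_of_nonneg_left h2 (by positivity)
    _ = ((1 / 2) ^ (levels m - 1) * m) * N (col M j) := by ring
    _ ≤ 2 * N (col M j) := mul_le_mul_of_nonneg_right h3 (apply_nonneg N _)

theorem norm_col_le_estimate (hN : IsMonotoneSymmetricNorm N) (hm : 2 ≤ m)
    {M : Matrix (Fin m) (Fin k) ℝ} (hM : ∀ i j, 0 ≤ M i j) (j : Fin k) :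
    N (col M j) ≤ 2 ^ (levels m - 1) * estimate N M j := by
  refine (norm_le_weight_one_mul_sum hN (by omega) fun i => hM i j).trans (le_of_eq ?_)
  have h : (2 : ℝ) ^ (levels m - 1) * (1 / 2) ^ (levels m - 1) = 1 := by
    rw [← mul_pow]; norm_num
  rw [estimate, mul_assoc (weight N 1), mul_left_comm, ← mul_assoc (2 ^ _), h, one_mul]
  rfl

theorem col_eq_zero_of_estimate_nonpos (hN : IsMonotoneSymmetricNorm N) (hm : 2 ≤ m)
    {M : Matrix (Fin m) (Fin k) ℝ} (hM : ∀ i j, 0 ≤ M i j) {j : Fin k}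
    (h : estimate N M j ≤ 0) : col M j = 0 := by
  refine hN.definite _ (le_antisymm ?_ (apply_nonneg N _))
  exact (norm_col_le_estimate hN hm hM j).trans
    (mul_nonpos_of_nonneg_of_nonpos (by positivity) h)

/-- At the start of a phase whose scale is large enough, the greedy choice is accepted. -/
theorem pot_greedy_le (hN : IsMonotoneSymmetricNorm N) (hm : 2 ≤ m)
    {M : Matrix (Fin m) (Fin k) ℝ} (hM : ∀ i j, 0 ≤ M i j) {j₀ j : Fin k} {lam : ℝ}
    (ha : 0 < estimate N M j₀) (hlam : 2 ^ (levels m + 1) * estimate N M j₀ ≤ lam)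
    (hj : IsGreedy N M lam 0 j) : pot N lam (0 + col M j) ≤ 2 * levels m := by
  have hl : 0 < lam := lt_of_lt_of_le (by positivity) hlam
  have h2 := two_le_levels hm
  have h2' : (2 : ℝ) ≤ levels m := by exact_mod_cast h2
  have hn := norm_col_le_estimate hN hm hM j₀
  have he : levels m + 1 = levels m - 1 + 2 := by omega
  rw [he, pow_add] at hlam
  have h := pot_add_le hN hm hl (y := 0) (z := col M j₀) (fun _ => le_rfl) (fun i => hM i j₀)
    (by linarith)
  have := hj j₀
  have := pot_zero_le (N := N) lam
  linarith

/-- Invariant after `t` jobs with total load `X`, where `O` bounds the optimum from above: `lam` is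
the scale and `Y` the load of the current phase, which began at job `s`. -/
structure Invariant (N : Seminorm ℝ (Fin m → ℝ)) (J : ℕ → Matrix (Fin m) (Fin k) ℝ) (t : ℕ)
    (X : Fin m → ℝ) (O lam : ℝ) (Y : Fin m → ℝ) : Prop where
  scale_nonneg : 0 ≤ lam
  load_nonneg : ∀ i, 0 ≤ Y i
  previous : N (X - Y) ≤ 6 * levels m ^ 2 * lam
  current : N Y ≤ 6 * levels m ^ 2 * lam
  greedy : ∃ s ≤ t, 0 < lam → ∀ x : ℕ → Fin k,
    2 * pot N lam Y ≤ pot N lam 0 + pot N lam (Y + load J s t x)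
  scale_le : lam ≤ 8 * O

/-- The greedy inequality survives a greedy step: the comparator pays at least as much as the
algorithm, and by supermodularity it would pay even more on top of the final load. -/
theorem greedy_step (hN : IsMonotoneSymmetricNorm N) (hm : 2 ≤ m) (hJ : ∀ t i j, 0 ≤ J t i j)
    {lam : ℝ} (hl : 0 < lam) {Y : Fin m → ℝ} (hY : ∀ i, 0 ≤ Y i) {s t : ℕ} (hst : s ≤ t)
    (h : ∀ x : ℕ → Fin k, 2 * pot N lam Y ≤ pot N lam 0 + pot N lam (Y + load J s t x))
    {j : Fin k} (hj : IsGreedy N (J t) lam Y j) (x : ℕ → Fin k) :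
    2 * pot N lam (Y + col (J t) j) ≤
      pot N lam 0 + pot N lam (Y + col (J t) j + load J s (t + 1) x) := by
  have hz := zero_le_load hJ s t x
  have hc : ∀ i, 0 ≤ col (J t) (x t) i := fun i => hJ t i (x t)
  have hc' : ∀ i, 0 ≤ col (J t) j i := fun i => hJ t i j
  have hload : load J s (t + 1) x = load J s t x + col (J t) (x t) := load_succ hst x
  rw [hload]
  have h1 := pot_add_add_pot_le hN hm hl (x := Y) (y := Y + load J s t x) (h := col (J t) (x t))
    hY (fun i => le_add_of_nonneg_right (hz i)) hc
  have h2 := pot_add_add_pot_le hN hm hl (x := Y) (y := Y + col (J t) j)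
    (h := load J s t x + col (J t) (x t)) hY
    (fun i => le_add_of_nonneg_right (hc' i)) (fun i => add_nonneg (hz i) (hc i))
  have h3 := h x
  have h4 := hj (x t)
  rw [← add_assoc] at h2
  linarith

/-- While some solution for the phase has norm at most `lam / 4`, the potential stays small. -/
theorem pot_le_of_comparator (hN : IsMonotoneSymmetricNorm N) (hm : 2 ≤ m) {lam : ℝ}
    (hl : 0 < lam) {Y z : Fin m → ℝ} (hY : ∀ i, 0 ≤ Y i) (hz : ∀ i, 0 ≤ z i)
    (h : 2 * pot N lam Y ≤ pot N lam 0 + pot N lam (Y + z)) (hz4 : 4 * N z ≤ lam) :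
    pot N lam Y ≤ 2 * levels m := by
  have h1 := pot_add_le hN hm hl hY hz hz4
  have h2 := pot_zero_le (N := N) lam
  have h3 : (2 : ℝ) ≤ levels m := by exact_mod_cast two_le_levels hm
  linarith

theorem Invariant.bump (hN : IsMonotoneSymmetricNorm N) (hm : 2 ≤ m)
    (hJ : ∀ t i j, 0 ≤ J t i j) (hk : 1 ≤ k) {t : ℕ} {X : Fin m → ℝ} {p q : ℝ × (Fin m → ℝ)}
    {j₀ : Fin k} (hj₀ : ∀ j', estimate N (J t) j₀ ≤ estimate N (J t) j')
    (h : Invariant N J t X (OPT N J (t + 1)) p.1 p.2)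
    (hb : Bump N (J t) (estimate N (J t) j₀) p q) :
    Invariant N J t X (OPT N J (t + 1)) q.1 q.2 := by
  obtain ⟨lam, Y⟩ := p
  obtain ⟨hfail, rfl⟩ := hb
  simp only at h hfail ⊢
  have hest : estimate N (J t) j₀ ≤ 2 * OPT N J (t + 1) := by
    have : estimate N (J t) j₀ / 2 ≤ OPT N J (t + 1) := by
      refine le_OPT hk fun x => ?_
      have h1 := (hj₀ (x t)).trans (estimate_le hN hm (fun i j => hJ t i j) (x t))
      have h2 : N (col (J t) (x t)) ≤ N (load J 0 (t + 1) x) := by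
        have := norm_load_mono hN hJ (Nat.zero_le t) (le_refl (t + 1)) x
        rwa [load_succ le_rfl, load_self, zero_add] at this
      linarith
    linarith
  have hO := OPT_nonneg (N := N) (J := J) hk (t + 1)
  have hlamO : lam ≤ 4 * OPT N J (t + 1) := by
    rcases hfail with hf | ⟨j, hj, hf⟩
    · linarith
    · rcases eq_or_lt_of_le h.scale_nonneg with h0 | hl
      · linarith
      · obtain ⟨s, hst, hg⟩ := h.greedy
        have : lam / 4 ≤ OPT N J (t + 1) := by
          refine le_OPT hk fun x => ?_
          by_contra hlt
          push Not at hlt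
          have h1 := norm_load_mono hN hJ (Nat.zero_le s) (le_refl (t + 1)) x
          have h2 := pot_le_of_comparator hN hm hl
            (Y := Y + col (J t) j) (fun i => add_nonneg (h.load_nonneg i) (hJ t i j))
            (zero_le_load hJ s (t + 1) x)
            (greedy_step hN hm hJ hl h.load_nonneg hst (hg hl) hj x) (by linarith)
          linarith
        linarith
  have hlam' : lam ≤ max (2 * lam) (estimate N (J t) j₀) :=
    le_trans (by linarith [h.scale_nonneg]) (le_max_left _ _)
  have h2lam : 2 * lam ≤ max (2 * lam) (estimate N (J t) j₀) := le_max_left _ _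
  have h0 := h.scale_nonneg.trans hlam'
  refine ⟨h0, fun _ => le_rfl, ?_, ?_, ⟨t, le_rfl, fun _ x => ?_⟩, ?_⟩
  · have e : X - 0 = (X - Y) + Y := by rw [sub_zero, sub_add_cancel]
    rw [e]
    calc N (X - Y + Y) ≤ N (X - Y) + N Y := map_add_le_add N _ _
      _ ≤ 6 * levels m ^ 2 * (2 * lam) := by linarith [h.previous, h.current]
      _ ≤ _ := mul_le_mul_of_nonneg_left h2lam (by positivity)
  · rw [map_zero]; positivity
  · rw [load_self]; simp [two_mul]
  · exact max_le (by linarith) (by linarith)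

theorem Invariant.job (hN : IsMonotoneSymmetricNorm N) (hm : 2 ≤ m)
    (hJ : ∀ t i j, 0 ≤ J t i j) (hk : 1 ≤ k) {t : ℕ} {X : Fin m → ℝ} {p q : ℝ × (Fin m → ℝ)}
    {j : Fin k} (h : Invariant N J t X (OPT N J t) p.1 p.2) (hs : JobSpec N (J t) p q j) :
    Invariant N J (t + 1) (X + col (J t) j) (OPT N J (t + 1)) q.1 q.2 := by
  have hO := OPT_mono hN hJ hk t
  obtain ⟨j₀, hj₀, ⟨h1, rfl, rfl⟩ | ⟨h1, p', hp', h2, h3, h4, rfl⟩⟩ := hs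
  · have hcol := col_eq_zero_of_estimate_nonpos hN hm (fun i j => hJ t i j) h1
    obtain ⟨s, hst, hg⟩ := h.greedy
    rw [hcol, add_zero]
    refine ⟨h.scale_nonneg, h.load_nonneg, h.previous, h.current,
      ⟨s, hst.trans (Nat.le_succ t), fun hl x => ?_⟩, by linarith [h.scale_le]⟩
    refine (hg hl x).trans ?_
    have := pot_mono hN hm hl (x := q.2 + load J s t x) (y := q.2 + load J s (t + 1) x)
      (fun i => add_nonneg (h.load_nonneg i) (zero_le_load hJ s t x i)) (fun i => by
        rw [load_succ hst, Pi.add_apply, Pi.add_apply, Pi.add_apply]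
        linarith [hJ t i (x t)])
    linarith
  · have hinv : Invariant N J t X (OPT N J (t + 1)) p'.1 p'.2 := by
      have hstart : Invariant N J t X (OPT N J (t + 1)) p.1 p.2 :=
        ⟨h.scale_nonneg, h.load_nonneg, h.previous, h.current, h.greedy,
          by linarith [h.scale_le]⟩
      clear h2 h3 h4
      induction hp' with
      | refl => exact hstart
      | tail _ hb ih => exact ih.bump hN hm hJ hk hj₀ hb
    obtain ⟨lam, Y⟩ := p'
    simp only at hinv h2 h3 h4 ⊢
    have hl : 0 < lam := h1.trans_le h2
    obtain ⟨s, hst, hg⟩ := hinv.greedy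
    have hY' : ∀ i, 0 ≤ (Y + col (J t) j) i := fun i => add_nonneg (hinv.load_nonneg i) (hJ t i j)
    refine ⟨hinv.scale_nonneg, hY', ?_, norm_le_of_pot_le hN hm hl hY' h4,
      ⟨s, hst.trans (Nat.le_succ t), fun _ x =>
        greedy_step hN hm hJ hl hinv.load_nonneg hst (hg hl) h3 x⟩, hinv.scale_le⟩
    rw [add_sub_add_right_eq_sub]
    exact hinv.previous

theorem norm_load_le_OPT (hN : IsMonotoneSymmetricNorm N) (hm : 2 ≤ m)
    (hJ : ∀ t i j, 0 ≤ J t i j) (hk : 1 ≤ k) {st : ℕ → ℝ × (Fin m → ℝ)} {x : ℕ → Fin k}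
    (h0 : st 0 = (0, 0)) (hs : ∀ t, JobSpec N (J t) (st t) (st (t + 1)) (x t)) (T : ℕ) :
    N (load J 0 T x) ≤ 96 * levels m ^ 2 * OPT N J T := by
  have hinv : ∀ t, Invariant N J t (load J 0 t x) (OPT N J t) (st t).1 (st t).2 := by
    intro t
    induction t with
    | zero =>
      rw [h0, load_self]
      refine ⟨le_rfl, fun _ => le_rfl, by simp, by simp, ⟨0, le_rfl, fun h => ?_⟩, ?_⟩
      · exact absurd h (lt_irrefl _)
      · have := OPT_nonneg (N := N) (J := J) hk 0
        simpa using this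
    | succ t ih =>
      rw [load_succ (Nat.zero_le t)]
      exact ih.job hN hm hJ hk (hs t)
  have h := hinv T
  have e : load J 0 T x = (load J 0 T x - (st T).2) + (st T).2 := (sub_add_cancel _ _).symm
  rw [e]
  calc _ ≤ N (load J 0 T x - (st T).2) + N (st T).2 := map_add_le_add N _ _
    _ ≤ 12 * levels m ^ 2 * (st T).1 := by linarith [h.previous, h.current]
    _ ≤ 12 * levels m ^ 2 * (8 * OPT N J T) :=
        mul_le_mul_of_nonneg_left h.scale_le (by positivity)
    _ = _ := by ring

theorem levels_sq_le (hm : 2 ≤ m) : (levels m : ℝ) ^ 2 ≤ 9 * Real.log m ^ 2 := by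
  have h1 : (levels m : ℝ) ≤ 2 * Nat.log 2 m := by
    have : 1 ≤ Nat.log 2 m := Nat.le_log_of_pow_le (by norm_num) (by simpa using hm)
    unfold levels
    push_cast
    have : (1 : ℝ) ≤ Nat.log 2 m := by exact_mod_cast this
    linarith
  have h2 : (Nat.log 2 m : ℝ) * Real.log 2 ≤ Real.log m := by
    rw [← Real.log_pow]
    refine Real.log_le_log (by positivity) ?_
    exact_mod_cast Nat.pow_log_le_self 2 (by omega)
  have h3 := Real.log_two_gt_d9
  have h4 : (0 : ℝ) ≤ Nat.log 2 m := Nat.cast_nonneg _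
  have h5 : (levels m : ℝ) ≤ 3 * Real.log m := by nlinarith
  calc (levels m : ℝ) ^ 2 ≤ (3 * Real.log m) ^ 2 := by gcongr
    _ = _ := by ring

end Competitive

/-! ### Reasoning about programs -/

section Machine

variable {m : ℕ} {O : (Fin m → ℝ) → ℝ}

/-- Started with memory `s` on top of any stack of programs, `P` is finished after at most `n`
steps, with a memory that satisfies `Q`. -/
def Run (O : (Fin m → ℝ) → ℝ) (P : Program) (s : Memory) (n : ℕ) (Q : Memory → Prop) : Prop :=
  ∃ s' n', n' ≤ n ∧ (∀ K, (step O)^[n'] (P :: K, s) = (K, s')) ∧ Q s'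

theorem Run.mono {P : Program} {s : Memory} {n n' : ℕ} {Q Q' : Memory → Prop}
    (h : Run O P s n Q) (hn : n ≤ n') (hQ : ∀ s', Q s' → Q' s') : Run O P s n' Q' := by
  obtain ⟨s', l, hl, hs, hq⟩ := h
  exact ⟨s', l, hl.trans hn, hs, hQ s' hq⟩

theorem Run.imp {P : Program} {s : Memory} {n : ℕ} {Q Q' : Memory → Prop}
    (h : Run O P s n Q) (hQ : ∀ s', Q s' → Q' s') : Run O P s n Q' :=
  h.mono le_rfl hQ

theorem run_setInt {v : ℕ} {e : IExpr} {s : Memory} {Q : Memory → Prop}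
    (h : Q (s.writeInt v (e.eval s))) : Run O (.setInt v e) s 1 Q :=
  ⟨_, 1, le_rfl, fun _ => rfl, h⟩

theorem run_setReal {a : ℕ} {e : IExpr} {r : RExpr} {s : Memory} {Q : Memory → Prop}
    (h : Q (s.writeReal a (e.eval s) (r.eval s))) : Run O (.setReal a e r) s 1 Q :=
  ⟨_, 1, le_rfl, fun _ => rfl, h⟩

theorem run_query {a b : ℕ} {e : IExpr} {s : Memory} {Q : Memory → Prop}
    (h : Q (s.writeReal b (e.eval s) (O fun i => s.real a i))) : Run O (.query a b e) s 1 Q :=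
  ⟨_, 1, le_rfl, fun _ => rfl, h⟩

theorem run_seq {P P' : Program} {s : Memory} {n n' : ℕ} {Q : Memory → Prop}
    (h : Run O P s n fun s' => Run O P' s' n' Q) : Run O (.seq P P') s (n + n' + 1) Q := by
  obtain ⟨s₁, l₁, hl₁, hs₁, s₂, l₂, hl₂, hs₂, hq⟩ := h
  refine ⟨s₂, l₂ + (l₁ + 1), by omega, fun K => ?_, hq⟩
  rw [Function.iterate_add_apply, Function.iterate_succ_apply]
  simp only [step]
  rw [hs₁, hs₂]

theorem run_ite {c : Comparison} {P P' : Program} {s : Memory} {n : ℕ} {Q : Memory → Prop}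
    (h1 : c.Holds s → Run O P s n Q) (h2 : ¬ c.Holds s → Run O P' s n Q) :
    Run O (.ite c P P') s (n + 1) Q := by
  by_cases hc : c.Holds s
  · obtain ⟨s', l, hl, hs, hq⟩ := h1 hc
    refine ⟨s', l + 1, by omega, fun K => ?_, hq⟩
    rw [Function.iterate_succ_apply]
    simp only [step, if_pos hc]
    exact hs K
  · obtain ⟨s', l, hl, hs, hq⟩ := h2 hc
    refine ⟨s', l + 1, by omega, fun K => ?_, hq⟩
    rw [Function.iterate_succ_apply]
    simp only [step, if_neg hc]
    exact hs K

/-- A loop with an invariant that counts the iterations, of which there are at most `n`. -/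
theorem run_loop {c : Comparison} {P : Program} {n t : ℕ} (Inv : ℕ → Memory → Prop)
    {Q : Memory → Prop} {s : Memory} (h0 : Inv 0 s)
    (hP : ∀ i s', Inv i s' → c.Holds s' → i < n ∧ Run O P s' t (Inv (i + 1)))
    (hQ : ∀ i s', Inv i s' → ¬ c.Holds s' → Q s') :
    Run O (.loop c P) s (n * (t + 1) + 1) Q := by
  suffices H : ∀ d i s', n - i ≤ d → Inv i s' → Run O (.loop c P) s' (d * (t + 1) + 1) Q from
    H n 0 s (by omega) h0
  intro d
  induction d with
  | zero =>
    intro i s' hd hi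
    by_cases hc : c.Holds s'
    · have := (hP i s' hi hc).1
      omega
    · exact ⟨s', 1, by omega, fun K => by simp [step, hc], hQ i s' hi hc⟩
  | succ d ih =>
    intro i s' hd hi
    by_cases hc : c.Holds s'
    · obtain ⟨hin, s₁, l₁, hl₁, hs₁, h1⟩ := hP i s' hi hc
      obtain ⟨s₂, l₂, hl₂, hs₂, hq⟩ := ih (i + 1) s₁ (by omega) h1
      refine ⟨s₂, l₂ + (l₁ + 1), by rw [Nat.succ_mul]; omega, fun K => ?_, hq⟩
      rw [Function.iterate_add_apply, Function.iterate_succ_apply]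
      simp only [step, if_pos hc]
      rw [hs₁, hs₂]
    · exact ⟨s', 1, by omega, fun K => by simp [step, hc], hQ i s' hi hc⟩

@[simp] theorem Memory.writeInt_idx (s : Memory) (v n w : ℕ) :
    (s.writeInt v n).idx w = if w = v then n else s.idx w := by
  simp [Memory.writeInt, Function.update_apply]

@[simp] theorem Memory.writeInt_real (s : Memory) (v n : ℕ) : (s.writeInt v n).real = s.real := rfl

@[simp] theorem Memory.writeReal_idx (s : Memory) (a i : ℕ) (r : ℝ) :
    (s.writeReal a i r).idx = s.idx := rfl

@[simp] theorem Memory.writeReal_real (s : Memory) (a i : ℕ) (r : ℝ) (b : ℕ) :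
    (s.writeReal a i r).real b = if b = a then Function.update (s.real a) i r else s.real b := by
  simp [Memory.writeReal, Function.update_apply]

/-- The memories agree on all integer variables and all arrays with a number below `b`, the array
`A` excepted. -/
def AgreeExcept (b A : ℕ) (s s' : Memory) : Prop :=
  (∀ v < b, s'.idx v = s.idx v) ∧ ∀ a < b, a ≠ A → s'.real a = s.real a

/-- The memories agree on all integer variables and all arrays with a number below `b`. A program
fragment with base `b` may change everything from `b` on and nothing below. -/
def Agree (b : ℕ) (s s' : Memory) : Prop :=
  (∀ v < b, s'.idx v = s.idx v) ∧ ∀ a < b, s'.real a = s.real a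

theorem Agree.refl (b : ℕ) (s : Memory) : Agree b s s := ⟨fun _ _ => rfl, fun _ _ => rfl⟩

theorem Agree.trans {b : ℕ} {s₁ s₂ s₃ : Memory} (h : Agree b s₁ s₂) (h' : Agree b s₂ s₃) :
    Agree b s₁ s₃ :=
  ⟨fun v hv => (h'.1 v hv).trans (h.1 v hv), fun a ha => (h'.2 a ha).trans (h.2 a ha)⟩

theorem Agree.mono {b b' : ℕ} {s s' : Memory} (h : Agree b s s') (hb : b' ≤ b) : Agree b' s s' :=
  ⟨fun v hv => h.1 v (hv.trans_le hb), fun a ha => h.2 a (ha.trans_le hb)⟩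

theorem Agree.except {b A : ℕ} {s s' : Memory} (h : Agree b s s') : AgreeExcept b A s s' :=
  ⟨h.1, fun a ha _ => h.2 a ha⟩

theorem AgreeExcept.trans {b A : ℕ} {s₁ s₂ s₃ : Memory} (h : AgreeExcept b A s₁ s₂)
    (h' : AgreeExcept b A s₂ s₃) : AgreeExcept b A s₁ s₃ :=
  ⟨fun v hv => (h'.1 v hv).trans (h.1 v hv), fun a ha hA => (h'.2 a ha hA).trans (h.2 a ha hA)⟩

theorem AgreeExcept.mono {b b' A : ℕ} {s s' : Memory} (h : AgreeExcept b A s s') (hb : b' ≤ b) :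
    AgreeExcept b' A s s' :=
  ⟨fun v hv => h.1 v (hv.trans_le hb), fun a ha => h.2 a (ha.trans_le hb)⟩

theorem AgreeExcept.agree {b A : ℕ} {s s' : Memory} (h : AgreeExcept b A s s') (hb : b ≤ A) :
    Agree b s s' :=
  ⟨h.1, fun a ha => h.2 a ha (by omega)⟩

theorem Agree.writeInt {b v n : ℕ} {s s' : Memory} (h : Agree b s s') (hv : b ≤ v) :
    Agree b s (s'.writeInt v n) :=
  ⟨fun w hw => by rw [Memory.writeInt_idx, if_neg (by omega)]; exact h.1 w hw, h.2⟩

theorem Agree.writeReal {b a i : ℕ} {r : ℝ} {s s' : Memory} (h : Agree b s s') (ha : b ≤ a) :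
    Agree b s (s'.writeReal a i r) :=
  ⟨h.1, fun w hw => by rw [Memory.writeReal_real, if_neg (by omega)]; exact h.2 w hw⟩

theorem AgreeExcept.writeInt {b A v n : ℕ} {s s' : Memory} (h : AgreeExcept b A s s')
    (hv : b ≤ v) : AgreeExcept b A s (s'.writeInt v n) :=
  ⟨fun w hw => by rw [Memory.writeInt_idx, if_neg (by omega)]; exact h.1 w hw, h.2⟩

theorem AgreeExcept.writeReal {b A i : ℕ} {r : ℝ} {s s' : Memory} (h : AgreeExcept b A s s') :
    AgreeExcept b A s (s'.writeReal A i r) :=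
  ⟨h.1, fun w hw hA => by rw [Memory.writeReal_real, if_neg hA]; exact h.2 w hw hA⟩

/-- `for v = 0, …, (var bound) - 1 do body`. -/
def forLoop (v bound : ℕ) (body : Program) : Program :=
  .seq (.setInt v (.const 0))
    (.loop (.int (.add (.var v) (.const 1)) (.var bound))
      (.seq body (.setInt v (.add (.var v) (.const 1)))))

theorem run_forLoop {v bound n t : ℕ} {body : Program} (Inv : ℕ → Memory → Prop)
    {Q : Memory → Prop} {s : Memory} (h0 : Inv 0 (s.writeInt v 0))
    (hn : ∀ i s', Inv i s' → s'.idx v = i ∧ s'.idx bound = n)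
    (hb : ∀ i < n, ∀ s', Inv i s' →
      Run O body s' t fun s'' => s''.idx v = i ∧ Inv (i + 1) (s''.writeInt v (i + 1)))
    (hQ : ∀ s', Inv n s' → Q s') :
    Run O (forLoop v bound body) s (n * (t + 3) + 3) Q := by
  have h1 : Run O (forLoop v bound body) s (1 + (n * (t + 1 + 1 + 1) + 1) + 1) Q := by
    refine run_seq (run_setInt ?_)
    refine run_loop (fun i s' => i ≤ n ∧ Inv i s') ⟨Nat.zero_le _, h0⟩ ?_ ?_
    · rintro i s' ⟨_, hi⟩ hc
      obtain ⟨e1, e2⟩ := hn i s' hi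
      simp only [Comparison.Holds, IExpr.eval, e1, e2] at hc
      refine ⟨hc, run_seq (Run.imp (hb i hc s' hi) ?_)⟩
      rintro s'' ⟨e3, h⟩
      refine run_setInt ⟨hc, ?_⟩
      simpa only [IExpr.eval, e3] using h
    · rintro i s' ⟨hin, hi⟩ hc
      obtain ⟨e1, e2⟩ := hn i s' hi
      simp only [Comparison.Holds, IExpr.eval, e1, e2] at hc
      have : i = n := by omega
      subst this
      exact hQ s' hi
  exact h1.mono (by ring_nf; omega) fun _ h => h

/-- Iterates the assignment of `op` to the integer variable `b + 1`, which starts with `init`. -/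
def iterInt (b bound : ℕ) (init op : IExpr) : Program :=
  .seq (.setInt (b + 1) init) (forLoop b bound (.setInt (b + 1) op))

theorem run_iterInt {b bound n : ℕ} {init op : IExpr} {s : Memory} (F : ℕ → ℕ)
    (hbound : bound < b) (hn : s.idx bound = n) (h0 : init.eval s = F 0)
    (hop : ∀ i < n, ∀ s', Agree b s s' → s'.idx (b + 1) = F i → op.eval s' = F (i + 1)) :
    Run O (iterInt b bound init op) s (n * 4 + 5) fun s' =>
      Agree b s s' ∧ s'.idx (b + 1) = F n := by
  have h1 : Run O (iterInt b bound init op) s (1 + (n * (1 + 3) + 3) + 1) fun s' =>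
      Agree b s s' ∧ s'.idx (b + 1) = F n := by
    refine run_seq (run_setInt ?_)
    refine run_forLoop (fun i s' => Agree b s s' ∧ s'.idx (b + 1) = F i ∧ s'.idx b = i)
      ?_ ?_ ?_ ?_
    · refine ⟨((Agree.refl b s).writeInt (by omega)).writeInt le_rfl, by simp [h0], by simp⟩
    · rintro i s' ⟨h, -, e⟩
      exact ⟨e, by rw [h.1 _ hbound, hn]⟩
    · rintro i hi s' ⟨h, e1, e2⟩
      refine run_setInt ⟨by simp [e2], (h.writeInt (by omega)).writeInt le_rfl, ?_, by simp⟩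
      simp [hop i hi s' h e1]
    · rintro s' ⟨h, e, -⟩
      exact ⟨h, e⟩
  exact h1.mono (by omega) fun _ h => h

/-- Accumulates a real number in the array `b`: starts with `init`, and assigns `op` after each run
of `body`. If there is nothing to be run, `body` is an assignment to an unused integer variable. -/
def foldReal (b bound : ℕ) (init : RExpr) (body : Program) (op : RExpr) : Program :=
  .seq (.setReal b (.const 0) init) (forLoop b bound (.seq body (.setReal b (.const 0) op)))

theorem run_foldReal {b bound n t : ℕ} {init op : RExpr} {body : Program} {s : Memory}
    (F : ℕ → ℝ) (hbound : bound < b) (hn : s.idx bound = n) (h0 : init.eval s = F 0)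
    (hb : ∀ i < n, ∀ s', Agree b s s' → s'.idx b = i → s'.real b 0 = F i →
      Run O body s' t fun s'' => Agree (b + 1) s' s'' ∧ op.eval s'' = F (i + 1)) :
    Run O (foldReal b bound init body op) s (n * (t + 5) + 5) fun s' =>
      Agree b s s' ∧ s'.real b 0 = F n := by
  have h1 : Run O (foldReal b bound init body op) s (1 + (n * (t + 1 + 1 + 3) + 3) + 1) fun s' =>
      Agree b s s' ∧ s'.real b 0 = F n := by
    refine run_seq (run_setReal ?_)
    refine run_forLoop (fun i s' => Agree b s s' ∧ s'.real b 0 = F i ∧ s'.idx b = i)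
      ?_ ?_ ?_ ?_
    · exact ⟨((Agree.refl b s).writeReal le_rfl).writeInt le_rfl, by simp [h0, IExpr.eval],
        by simp⟩
    · rintro i s' ⟨h, -, e⟩
      exact ⟨e, by rw [h.1 _ hbound, hn]⟩
    · rintro i hi s' ⟨h, e1, e2⟩
      refine run_seq (Run.imp (hb i hi s' h e2 e1) ?_)
      rintro s'' ⟨h', e3⟩
      refine run_setReal ⟨?_, ?_, ?_, by simp⟩
      · simp [h'.1 b (by omega), e2]
      · exact ((h.trans (h'.mono (by omega))).writeReal le_rfl).writeInt le_rfl
      · simp [e3, IExpr.eval]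
    · rintro s' ⟨h, e, -⟩
      exact ⟨h, e⟩
  exact h1.mono (by ring_nf; omega) fun _ h => h

/-- `for i = 0, …, (var bound) - 1`: run `body` and store its result at position `i` of the
array `A`. The loop variable and the base of the fragment is `b`; the result of `body` is expected
at position `0` of the array `b + 1`. -/
def writeLoop (b A bound : ℕ) (body : Program) : Program :=
  forLoop b bound (.seq body (.setReal A (.var b) (.read (b + 1) (.const 0))))

theorem run_writeLoop {b A bound n t : ℕ} {body : Program} {s : Memory} (F : ℕ → ℝ)
    (hA : A ≤ b) (hbound : bound < b) (hn : s.idx bound = n)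
    (hb : ∀ i < n, ∀ s', AgreeExcept b A s s' → (∀ p, i ≤ p → s'.real A p = s.real A p) →
      s'.idx b = i → Run O body s' t fun s'' => Agree (b + 1) s' s'' ∧ s''.real (b + 1) 0 = F i) :
    Run O (writeLoop b A bound body) s (n * (t + 5) + 3) fun s' =>
      AgreeExcept b A s s' ∧ ∀ i < n, s'.real A i = F i := by
  have h1 : Run O (writeLoop b A bound body) s (n * (t + 1 + 1 + 3) + 3) fun s' =>
      AgreeExcept b A s s' ∧ ∀ i < n, s'.real A i = F i := by
    refine run_forLoop (fun i s' => AgreeExcept b A s s' ∧ (∀ p, i ≤ p → s'.real A p = s.real A p) ∧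
      (∀ p < i, s'.real A p = F p) ∧ s'.idx b = i) ?_ ?_ ?_ ?_
    · exact ⟨(Agree.refl b s).except.writeInt le_rfl, by simp, by simp, by simp⟩
    · rintro i s' ⟨h, -, -, e⟩
      exact ⟨e, by rw [h.1 _ hbound, hn]⟩
    · rintro i hi s' ⟨h, e1, e2, e3⟩
      refine run_seq (Run.imp (hb i hi s' h e1 e3) ?_)
      rintro s'' ⟨h', e4⟩
      have e5 : s''.idx b = i := by rw [h'.1 b (by omega), e3]
      have e6 : s''.real A = s'.real A := h'.2 A (by omega)
      refine run_setReal ⟨by simp [e5], ?_, ?_, ?_, by simp⟩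
      · exact ((h.trans (h'.mono (by omega)).except).writeReal).writeInt le_rfl
      · intro p hp
        simp only [Memory.writeInt_real, Memory.writeReal_real, if_true, IExpr.eval, e5, e6]
        rw [Function.update_of_ne (by omega)]
        exact e1 p (by omega)
      · intro p hp
        simp only [Memory.writeInt_real, Memory.writeReal_real, if_true, IExpr.eval, RExpr.eval,
          e4, e5, e6]
        rcases eq_or_ne p i with rfl | hne
        · simp
        · rw [Function.update_of_ne hne]
          exact e2 p (by omega)
    · rintro s' ⟨h, -, e, -⟩
      exact ⟨h, e⟩
  exact h1.mono (by ring_nf; omega) fun _ h => h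

/-- Finds a minimizer of a function on `0, …, (var bound) - 1`, whose values are
computed by `body` in the array `b + 2`. The minimizer is left in the integer variable `b + 1` and
the minimum in the array `b`. -/
def argmin (b bound : ℕ) (body : Program) : Program :=
  forLoop b bound (.seq body
    (.ite (.int (.var b) (.const 0))
      (.seq (.setInt (b + 1) (.var b)) (.setReal b (.const 0) (.read (b + 2) (.const 0))))
      (.ite (.real (.read (b + 2) (.const 0)) (.read b (.const 0)))
        (.seq (.setInt (b + 1) (.var b)) (.setReal b (.const 0) (.read (b + 2) (.const 0))))
        (.setInt (b + 2) (.const 0)))))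

theorem run_argmin {b bound n t : ℕ} {body : Program} {s : Memory} (F : ℕ → ℝ) (hn0 : 1 ≤ n)
    (hbound : bound < b) (hn : s.idx bound = n)
    (hb : ∀ i < n, ∀ s', Agree b s s' → s'.idx b = i →
      Run O body s' t fun s'' => Agree (b + 2) s' s'' ∧ s''.real (b + 2) 0 = F i) :
    Run O (argmin b bound body) s (n * (t + 9) + 3) fun s' =>
      Agree b s s' ∧ s'.idx (b + 1) < n ∧ s'.real b 0 = F (s'.idx (b + 1)) ∧
        ∀ i < n, F (s'.idx (b + 1)) ≤ F i := by
  have h1 : Run O (argmin b bound body) s (n * (t + (3 + 1 + 1) + 1 + 3) + 3) fun s' =>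
      Agree b s s' ∧ s'.idx (b + 1) < n ∧ s'.real b 0 = F (s'.idx (b + 1)) ∧
        ∀ i < n, F (s'.idx (b + 1)) ≤ F i := by
    refine run_forLoop (fun i s' => (Agree b s s' ∧ s'.idx b = i) ∧
      (1 ≤ i → s'.idx (b + 1) < i ∧ s'.real b 0 = F (s'.idx (b + 1)) ∧
        ∀ p < i, F (s'.idx (b + 1)) ≤ F p)) ?_ ?_ ?_ ?_
    · exact ⟨⟨(Agree.refl b s).writeInt le_rfl, by simp⟩, by simp⟩
    · rintro i s' ⟨⟨h, e⟩, -⟩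
      exact ⟨e, by rw [h.1 _ hbound, hn]⟩
    · rintro i hi s' ⟨⟨h, e⟩, hmin⟩
      refine run_seq (Run.imp (hb i hi s' h e) ?_)
      rintro s'' ⟨h', e'⟩
      have e2 : s''.idx b = i := by rw [h'.1 b (by omega), e]
      have e3 : s''.idx (b + 1) = s'.idx (b + 1) := h'.1 _ (by omega)
      have e4 : s''.real b = s'.real b := h'.2 b (by omega)
      have hag : Agree b s s'' := h.trans (h'.mono (by omega))
      have hupd : (∀ p < i, F i ≤ F p) → Run O
          (.seq (.setInt (b + 1) (.var b)) (.setReal b (.const 0) (.read (b + 2) (.const 0)))) s''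
          (1 + 1 + 1) fun s'' => s''.idx b = i ∧ ((Agree b s (s''.writeInt b (i + 1)) ∧
            (s''.writeInt b (i + 1)).idx b = i + 1) ∧
          (1 ≤ i + 1 → (s''.writeInt b (i + 1)).idx (b + 1) < i + 1 ∧
            (s''.writeInt b (i + 1)).real b 0 = F ((s''.writeInt b (i + 1)).idx (b + 1)) ∧
            ∀ p < i + 1, F ((s''.writeInt b (i + 1)).idx (b + 1)) ≤ F p)) := by
        intro hmin'
        refine run_seq (run_setInt (run_setReal
          ⟨by simp [e2], ⟨?_, by simp⟩, fun _ => ⟨?_, ?_, ?_⟩⟩))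
        · exact ((hag.writeInt (by omega)).writeReal le_rfl).writeInt le_rfl
        · simp [IExpr.eval, e2]
        · simp [IExpr.eval, RExpr.eval, e2, e']
        · intro p hp
          simp only [Memory.writeInt_idx, Memory.writeReal_idx, IExpr.eval, e2]
          simp only [Nat.add_eq_left, one_ne_zero, if_false, if_true]
          rcases eq_or_ne p i with rfl | hne
          · exact le_rfl
          · exact hmin' p (by omega)
      refine run_ite (fun hc => ?_) (fun hc => ?_)
      · simp only [Comparison.Holds, IExpr.eval, e2] at hc
        exact (hupd fun p hp => by omega).mono (by omega) fun _ h => h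
      · simp only [Comparison.Holds, IExpr.eval, e2] at hc
        obtain ⟨hm1, hm2, hm3⟩ := hmin (by omega)
        refine run_ite (fun hc2 => ?_) (fun hc2 => ?_)
        · simp only [Comparison.Holds, RExpr.eval, IExpr.eval, e', e4, hm2] at hc2
          exact hupd fun p hp => hc2.trans (hm3 p hp)
        · simp only [Comparison.Holds, RExpr.eval, IExpr.eval, e', e4, hm2, not_le] at hc2
          refine (run_setInt ?_).mono (by omega : 1 ≤ 3) fun _ h => h
          refine ⟨by simp [e2], ⟨(hag.writeInt (by omega)).writeInt le_rfl, by simp⟩,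
            fun _ => ⟨?_, ?_, ?_⟩⟩
          · simp [e3]; omega
          · simp [e3, e4, hm2]
          · intro p hp
            simp only [Memory.writeInt_idx, e3]
            simp only [Nat.add_eq_left, one_ne_zero, if_false, Nat.add_right_inj,
              OfNat.one_ne_ofNat]
            rcases eq_or_ne p i with rfl | hne
            · exact hc2.le
            · exact hm3 p (by omega)
    · rintro s' ⟨⟨h, -⟩, e⟩
      exact ⟨h, e hn0⟩
  exact h1.mono (by ring_nf; omega) fun _ h => h

theorem HaltsWithin.mono {P : Program} {s s' : Memory} {n n' : ℕ}
    (h : HaltsWithin O P s n s') (hn : n ≤ n') : HaltsWithin O P s n' s' := by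
  obtain ⟨d, rfl⟩ := Nat.exists_eq_add_of_le hn
  unfold HaltsWithin at h ⊢
  rw [add_comm, Function.iterate_add_apply, h]
  induction d with
  | zero => rfl
  | succ d ih => rw [Function.iterate_succ_apply]; exact ih (by omega)

theorem Run.haltsWithin {P : Program} {s : Memory} {n : ℕ} {Q : Memory → Prop}
    (h : Run O P s n Q) : ∃ s', HaltsWithin O P s n s' ∧ Q s' := by
  obtain ⟨s', l, hl, hs, hq⟩ := h
  exact ⟨s', HaltsWithin.mono (n := l) (hs []) hl, hq⟩

end Machine

/-! ### The program -/

section Program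

/-- Computes `levels m`, in the integer variable `3` and in the array `3`. -/
def levelsProg : Program :=
  .seq (.setInt 3 (.const 0)) (.seq (.setInt 4 (.const 1)) (.seq (.setReal 3 (.const 0) (.const 0))
    (.loop (.int (.var 4) (.var 0))
      (.seq (.setInt 3 (.add (.var 3) (.const 1))) (.seq (.setInt 4 (.add (.var 4) (.var 4)))
        (.setReal 3 (.const 0) (.add (.read 3 (.const 0)) (.const 1))))))))

/-- Computes `weight N (2 ^ r)`, where `r` is the integer variable `5`, with one oracle call. -/
def weightProg : Program :=
  .seq (iterInt 6 5 (.const 1) (.add (.var 7) (.var 7)))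
    (.seq (foldReal 8 5 (.const 1) (.setInt 9 (.const 0))
        (.add (.read 8 (.const 0)) (.read 8 (.const 0))))
      (.seq (writeLoop 9 9 0 (.ite (.int (.add (.var 9) (.const 1)) (.var 7))
          (.setReal 10 (.const 0) (.const 1)) (.setReal 10 (.const 0) (.const 0))))
        (.seq (.query 9 10 (.const 0))
          (.setReal 6 (.const 0) (.div (.read 8 (.const 0)) (.read 10 (.const 0)))))))

/-- Fills the arrays `5` and `6` with the numbers `weight N (2 ^ r)` and `(1 / 2) ^ r`. -/
def tablesProg : Program :=
  .seq (writeLoop 5 5 3 weightProg)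
    (writeLoop 6 6 3 (foldReal 7 6 (.const 1) (.setInt 8 (.const 0))
      (.mul (.const (1 / 2)) (.read 7 (.const 0)))))

/-- Computes the sum of the entries of the column whose number is the integer variable `7`. -/
def colSumProg : Program :=
  .seq (iterInt 9 7 (.const 0) (.add (.var 10) (.var 0)))
    (.seq (foldReal 11 0 (.const 0) (.setInt 12 (.const 0))
        (.add (.read 11 (.const 0)) (.read 0 (.add (.var 10) (.var 11)))))
      (.setReal 9 (.const 0) (.read 11 (.const 0))))

/-- Finds the option with the smallest estimate, in the integer variable `8`, and this estimate, in
the array `8`. -/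
def estimateProg : Program :=
  .seq (argmin 7 1 colSumProg)
    (.setReal 8 (.const 0) (.mul (.mul (.read 5 (.const 0)) (.read 6 (.sub (.var 3) (.const 1))))
      (.read 7 (.const 0))))

/-- Computes the term of the potential for the level `r` and the machine `i`, which are the integer
variables `14` and `15`; the column that is added to the load begins at position `13`. -/
def termProg : Program :=
  .seq (.setReal 17 (.const 0) (.div (.mul (.read 5 (.var 14))
      (.add (.read 2 (.var 15)) (.read 0 (.add (.var 13) (.var 15))))) (.read 1 (.const 0))))
    (.seq (.ite (.real (.read 17 (.const 0)) (.read 3 (.const 0)))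
        (.seq (.setReal 18 (.const 0) (.div (.add (.const 1)
            (.div (.read 17 (.const 0)) (.read 3 (.const 0)))) (.const 2)))
          (.setReal 19 (.const 0) (.const 0)))
        (.seq (.setReal 18 (.const 0) (.const 1))
          (.setReal 19 (.const 0) (.sub (.read 17 (.const 0)) (.read 3 (.const 0))))))
      (.seq (foldReal 20 3 (.const 1) (.setInt 21 (.const 0))
          (.mul (.read 20 (.const 0)) (.read 18 (.const 0))))
        (.setReal 16 (.const 0) (.mul (.read 6 (.var 14))
          (.add (.read 20 (.const 0)) (.read 19 (.const 0)))))))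

/-- Computes the potential after adding the column whose number is the integer variable `10`. -/
def potProg : Program :=
  .seq (iterInt 12 10 (.const 0) (.add (.var 13) (.var 0)))
    (.seq (foldReal 14 3 (.const 0)
        (foldReal 15 0 (.const 0) termProg (.add (.read 15 (.const 0)) (.read 16 (.const 0))))
        (.add (.read 14 (.const 0)) (.read 15 (.const 0))))
      (.setReal 12 (.const 0) (.read 14 (.const 0))))

/-- Starts a new phase. -/
def bumpProg : Program :=
  .seq (.ite (.real (.add (.read 1 (.const 0)) (.read 1 (.const 0))) (.read 8 (.const 0)))
      (.setReal 1 (.const 0) (.read 8 (.const 0)))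
      (.setReal 1 (.const 0) (.add (.read 1 (.const 0)) (.read 1 (.const 0)))))
    (writeLoop 12 2 0 (.setReal 13 (.const 0) (.const 0)))

/-- Finds the greedy choice, in the integer variable `11`, and starts a new phase or sets the flag
in the integer variable `9`. -/
def attemptProg : Program :=
  .seq (argmin 10 1 potProg)
    (.ite (.real (.read 8 (.const 0)) (.read 1 (.const 0)))
      (.ite (.real (.read 10 (.const 0)) (.add (.read 3 (.const 0)) (.read 3 (.const 0))))
        (.setInt 9 (.const 1)) bumpProg)
      bumpProg)

/-- Selects the greedy choice and adds its column to the load of the phase. -/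
def acceptProg : Program :=
  .seq (.setInt 2 (.var 11))
    (.seq (iterInt 12 11 (.const 0) (.add (.var 13) (.var 0)))
      (writeLoop 14 2 0 (.setReal 15 (.const 0)
        (.add (.read 2 (.var 14)) (.read 0 (.add (.var 13) (.var 14)))))))

/-- The program that is run for each job. Between jobs it keeps the scale in the array `1` and the
load of the current phase in the array `2`; all the rest is computed anew. -/
def jobProg : Program :=
  .seq levelsProg (.seq tablesProg (.seq estimateProg
    (.ite (.real (.read 8 (.const 0)) (.const 0)) (.setInt 2 (.var 8))
      (.seq (.setInt 9 (.const 0))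
        (.seq (.loop (.int (.var 9) (.const 0)) attemptProg) acceptProg)))))

end Program

/-! ### Correctness of the program -/

section Correctness

variable {m k : ℕ} {N : Seminorm ℝ (Fin m → ℝ)} {M : Matrix (Fin m) (Fin k) ℝ}

theorem run_levelsProg {O : (Fin m → ℝ) → ℝ} (hm : 2 ≤ m) {s : Memory} (h0 : s.idx 0 = m) :
    Run O levelsProg s (levels m * 6 + 7) fun s' =>
      Agree 3 s s' ∧ s'.idx 3 = levels m ∧ s'.real 3 0 = levels m := by
  have h1 : Run O levelsProg s
      (1 + (1 + (1 + (levels m * ((1 + (1 + 1 + 1) + 1) + 1) + 1) + 1) + 1) + 1) fun s' =>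
      Agree 3 s s' ∧ s'.idx 3 = levels m ∧ s'.real 3 0 = levels m := by
    refine run_seq (run_setInt (run_seq (run_setInt (run_seq (run_setReal ?_)))))
    refine run_loop (fun i s' => Agree 3 s s' ∧ i ≤ levels m ∧ s'.idx 3 = i ∧ s'.idx 4 = 2 ^ i ∧
      s'.real 3 0 = i) ?_ ?_ ?_
    · refine ⟨(((Agree.refl 3 s).writeInt le_rfl).writeInt (by norm_num)).writeReal le_rfl,
        Nat.zero_le _, ?_, ?_, ?_⟩ <;> simp [IExpr.eval, RExpr.eval]
    · rintro i s' ⟨h, hi, e1, e2, e3⟩ hc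
      simp only [Comparison.Holds, IExpr.eval, e2, h.1 0 (by norm_num), h0] at hc
      have hlt : i < levels m :=
        Nat.lt_succ_of_le (Nat.le_log_of_pow_le (by norm_num) hc)
      refine ⟨hlt, run_seq (run_setInt (run_seq (run_setInt (run_setReal ?_))))⟩
      refine ⟨((h.writeInt le_rfl).writeInt (by norm_num)).writeReal le_rfl, hlt, ?_, ?_, ?_⟩
      · simp [IExpr.eval, e1]
      · simp [IExpr.eval, e2, pow_succ]; ring
      · simp [IExpr.eval, RExpr.eval, e3]
    · rintro i s' ⟨h, hi, e1, e2, e3⟩ hc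
      simp only [Comparison.Holds, IExpr.eval, e2, h.1 0 (by norm_num), h0, not_le] at hc
      have : levels m ≤ i := Nat.log_lt_of_lt_pow (by omega) hc
      have hi' : i = levels m := by omega
      subst hi'
      exact ⟨h, e1, e3⟩
  exact h1.mono (by omega) fun _ h => h

theorem run_weightProg {s : Memory} {r L : ℕ} (h0 : s.idx 0 = m) (h5 : s.idx 5 = r) (hr : r ≤ L) :
    Run (ballOpt N) weightProg s (L * 10 + m * 8 + 19) fun s' =>
      Agree 6 s s' ∧ s'.real 6 0 = weight N (2 ^ r) := by
  have h1 : Run (ballOpt N) weightProg s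
      ((r * 4 + 5) + ((r * (1 + 5) + 5) + ((m * ((1 + 1) + 5) + 3) + (1 + 1 + 1) + 1) + 1) + 1)
      fun s' => Agree 6 s s' ∧ s'.real 6 0 = weight N (2 ^ r) := by
    refine run_seq (Run.imp (run_iterInt (fun i => 2 ^ i) (by norm_num) h5
      (by simp [IExpr.eval]) ?_) ?_)
    · intro i _ s' _ e
      simp only [Nat.reduceAdd] at e
      simp only [IExpr.eval, e, pow_succ]; ring
    rintro s₁ ⟨a1, e1⟩
    refine run_seq (Run.imp (run_foldReal (fun i => 2 ^ i) (by norm_num)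
      ((a1.1 5 (by norm_num)).trans h5) (by simp [RExpr.eval]) ?_) ?_)
    · intro i _ s' _ _ e
      refine run_setInt ⟨(Agree.refl _ _).writeInt le_rfl, ?_⟩
      simp only [RExpr.eval, IExpr.eval, Memory.writeInt_real, e, pow_succ]; ring
    rintro s₂ ⟨a2, e2⟩
    have e1' : s₂.idx 7 = 2 ^ r := (a2.1 7 (by norm_num)).trans e1
    have e0' : s₂.idx 0 = m :=
      ((a2.1 0 (by norm_num)).trans (a1.1 0 (by norm_num))).trans h0
    refine run_seq (n := m * ((1 + 1) + 5) + 3) (n' := 1 + 1 + 1)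
      (Run.imp (run_writeLoop (fun i => if i < 2 ^ r then 1 else 0) le_rfl (by norm_num)
      e0' ?_) ?_)
    · intro i _ s' ha _ e
      have e7 : s'.idx 7 = 2 ^ r := (ha.1 7 (by norm_num)).trans e1'
      refine run_ite (fun hc => ?_) (fun hc => ?_)
      all_goals
        simp only [Comparison.Holds, IExpr.eval, e, e7] at hc
        refine run_setReal ⟨(Agree.refl _ _).writeReal le_rfl, ?_⟩
      · rw [if_pos (by omega)]; simp [RExpr.eval, IExpr.eval]
      · rw [if_neg (by omega)]; simp [RExpr.eval, IExpr.eval]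
    rintro s₃ ⟨a3, e3⟩
    refine run_seq (run_query (run_setReal ⟨?_, ?_⟩))
    · have a3' : Agree 6 s₂ s₃ := (a3.mono (by norm_num)).agree (by norm_num)
      exact (((a1.trans (a2.mono (by norm_num))).trans a3').writeReal
        (by norm_num)).writeReal le_rfl
    · have e8 : s₃.real 8 0 = 2 ^ r := by rw [a3.2 8 (by norm_num) (by norm_num), e2]
      have e9 : (fun i : Fin m => s₃.real 9 i) = ind (initSeg m (2 ^ r)) := by
        funext i
        rw [e3 i i.2]
        simp [ind, initSeg]
      simp [RExpr.eval, IExpr.eval, e8, e9, weight]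
  exact h1.mono (by omega) fun _ h => h

theorem run_tablesProg {s : Memory} (h0 : s.idx 0 = m) (h3 : s.idx 3 = levels m) :
    Run (ballOpt N) tablesProg s
      (levels m * (levels m * 10 + m * 8 + 24) + levels m * (levels m * 6 + 10) + 7) fun s' =>
      Agree 5 s s' ∧ (∀ r < levels m, s'.real 5 r = weight N (2 ^ r)) ∧
        ∀ r < levels m, s'.real 6 r = (1 / 2) ^ r := by
  have h1 : Run (ballOpt N) tablesProg s
      ((levels m * ((levels m * 10 + m * 8 + 19) + 5) + 3) +
        (levels m * ((levels m * (1 + 5) + 5) + 5) + 3) + 1) fun s' =>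
      Agree 5 s s' ∧ (∀ r < levels m, s'.real 5 r = weight N (2 ^ r)) ∧
        ∀ r < levels m, s'.real 6 r = (1 / 2) ^ r := by
    refine run_seq (Run.imp (run_writeLoop (fun r => weight N (2 ^ r)) le_rfl
      (by norm_num) h3 ?_) ?_)
    · intro r hr s' ha _ e
      exact run_weightProg ((ha.1 0 (by norm_num)).trans h0) e hr.le
    rintro s₁ ⟨a1, e1⟩
    refine Run.imp (run_writeLoop (fun r => (1 / 2) ^ r) le_rfl (by norm_num)
      ((a1.1 3 (by norm_num)).trans h3) ?_) ?_
    · intro r hr s' ha _ e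
      refine (run_foldReal (fun i => (1 / 2) ^ i) (by norm_num) e (by simp [RExpr.eval]) ?_).mono
        (by gcongr) fun _ h => h
      intro i _ s'' _ _ e'
      refine run_setInt ⟨(Agree.refl _ _).writeInt le_rfl, ?_⟩
      simp only [RExpr.eval, IExpr.eval, Memory.writeInt_real, e', pow_succ]
      push_cast; ring
    · rintro s₂ ⟨a2, e2⟩
      refine ⟨(a1.agree le_rfl).trans ((a2.mono (by norm_num)).agree (by norm_num)), ?_, e2⟩
      intro r hr
      rw [a2.2 5 (by norm_num) (by norm_num), e1 r hr]
  exact h1.mono (by ring_nf; omega) fun _ h => h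

/-- The job is in the array `0`, and the tables that depend only on the norm are filled. -/
structure Ready (N : Seminorm ℝ (Fin m → ℝ)) (M : Matrix (Fin m) (Fin k) ℝ) (s : Memory) :
    Prop where
  machines : s.idx 0 = m
  options : s.idx 1 = k
  levels_idx : s.idx 3 = levels m
  levels_real : s.real 3 0 = levels m
  weight_table : ∀ r < levels m, s.real 5 r = weight N (2 ^ r)
  scale_table : ∀ r < levels m, s.real 6 r = (1 / 2) ^ r
  job : ∀ (i : Fin m) (j : Fin k), s.real 0 (j * m + i) = M i j

theorem Ready.of_agreeExcept {A : ℕ} {s s' : Memory} (h : Ready N M s)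
    (ha : AgreeExcept 7 A s s') (hA : A = 1 ∨ A = 2) : Ready N M s' := by
  obtain ⟨h1, h2⟩ := ha
  have e0 := h2 0 (by norm_num) (by omega)
  have e3 := h2 3 (by norm_num) (by omega)
  have e5 := h2 5 (by norm_num) (by omega)
  have e6 := h2 6 (by norm_num) (by omega)
  exact ⟨(h1 0 (by norm_num)).trans h.machines, (h1 1 (by norm_num)).trans h.options,
    (h1 3 (by norm_num)).trans h.levels_idx, e3 ▸ h.levels_real, e5 ▸ h.weight_table,
    e6 ▸ h.scale_table, e0 ▸ h.job⟩

theorem Ready.of_agree {s s' : Memory} (h : Ready N M s) (ha : Agree 7 s s') : Ready N M s' :=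
  h.of_agreeExcept (A := 1) ha.except (Or.inl rfl)

/-- The scale and the load of the current phase are `p`. -/
def HasState (s : Memory) (p : ℝ × (Fin m → ℝ)) : Prop :=
  s.real 1 0 = p.1 ∧ ∀ i : Fin m, s.real 2 i = p.2 i

theorem HasState.of_agree {b : ℕ} {s s' : Memory} {p : ℝ × (Fin m → ℝ)} (h : HasState s p)
    (ha : Agree b s s') (hb : 3 ≤ b) : HasState s' p := by
  refine ⟨?_, fun i => ?_⟩
  · rw [ha.2 1 (by omega)]; exact h.1
  · rw [ha.2 2 (by omega)]; exact h.2 i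

/-- A function on the options, extended to all numbers. -/
noncomputable def extend (f : Fin k → ℝ) (j : ℕ) : ℝ := if h : j < k then f ⟨j, h⟩ else 0

theorem extend_val (f : Fin k → ℝ) (j : Fin k) : extend f j = f j := by
  simp [extend]

theorem run_colSumProg {O : (Fin m → ℝ) → ℝ} {s : Memory} (hs : Ready N M s) (j : Fin k)
    (h7 : s.idx 7 = j) :
    Run O colSumProg s (k * 4 + m * 6 + 13) fun s' =>
      Agree 9 s s' ∧ s'.real 9 0 = ∑ i, col M j i := by
  have h1 : Run O colSumProg s ((j * 4 + 5) + ((m * (1 + 5) + 5) + 1 + 1) + 1) fun s' =>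
      Agree 9 s s' ∧ s'.real 9 0 = ∑ i, col M j i := by
    refine run_seq (Run.imp (run_iterInt (fun i => i * m) (by norm_num) h7 (by simp [IExpr.eval])
      ?_) ?_)
    · intro i _ s' ha e
      simp only [Nat.reduceAdd] at e
      simp only [IExpr.eval, e, ha.1 0 (by norm_num), hs.machines]; ring
    rintro s₁ ⟨a1, e1⟩
    simp only [Nat.reduceAdd] at e1
    refine run_seq (n := m * (1 + 5) + 5) (n' := 1) (Run.imp (run_foldReal
      (fun n => ∑ i ∈ Finset.range n, s.real 0 (j * m + i))
      (by norm_num) ((a1.1 0 (by norm_num)).trans hs.machines) (by simp [RExpr.eval]) ?_) ?_)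
    · intro i _ s' ha e e'
      refine run_setInt ⟨(Agree.refl _ _).writeInt le_rfl, ?_⟩
      rw [Finset.sum_range_succ, ← e']
      simp [RExpr.eval, IExpr.eval, e, ha.1 10 (by norm_num), e1, ha.2 0 (by norm_num),
        a1.2 0 (by norm_num)]
    · rintro s₂ ⟨a2, e2⟩
      refine run_setReal ⟨(a1.trans (a2.mono (by norm_num))).writeReal le_rfl, ?_⟩
      simp only [Memory.writeReal_real, if_true, IExpr.eval, RExpr.eval, Function.update_self, e2]
      rw [Finset.sum_range]
      exact Finset.sum_congr rfl fun i _ => hs.job i j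
  exact h1.mono (by have := j.2; omega) fun _ h => h

theorem run_estimateProg {O : (Fin m → ℝ) → ℝ} (hN : IsMonotoneSymmetricNorm N) (hm : 2 ≤ m)
    (hk : 1 ≤ k) {s : Memory} (hs : Ready N M s) :
    Run O estimateProg s (k * (k * 4 + m * 6 + 22) + 5) fun s' =>
      Agree 7 s s' ∧ ∃ j₀ : Fin k, s'.idx 8 = j₀ ∧ s'.real 8 0 = estimate N M j₀ ∧
        ∀ j, estimate N M j₀ ≤ estimate N M j := by
  have h1 : Run O estimateProg s ((k * ((k * 4 + m * 6 + 13) + 9) + 3) + 1 + 1) fun s' =>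
      Agree 7 s s' ∧ ∃ j₀ : Fin k, s'.idx 8 = j₀ ∧ s'.real 8 0 = estimate N M j₀ ∧
        ∀ j, estimate N M j₀ ≤ estimate N M j := by
    refine run_seq (n := k * ((k * 4 + m * 6 + 13) + 9) + 3) (n' := 1) (Run.imp (run_argmin
      (extend fun j => ∑ i, col M j i) hk (by norm_num) hs.options
      ?_) ?_)
    · intro j hj s' ha e
      have := run_colSumProg (O := O) (hs.of_agree ha) ⟨j, hj⟩ e
      simpa only [extend, hj, dif_pos] using this
    · rintro s₁ ⟨a1, hj, e1, e2⟩
      simp only [Nat.reduceAdd] at hj e1 e2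
      have hs₁ := hs.of_agree a1
      refine run_setReal ⟨a1.writeReal (by norm_num), ⟨s₁.idx 8, hj⟩, rfl, ?_, fun j => ?_⟩
      · have h2 := two_le_levels hm
        simp only [Memory.writeReal_real, if_true, IExpr.eval, RExpr.eval, Function.update_self, e1,
          hs₁.levels_idx, hs₁.weight_table 0 (by omega), hs₁.scale_table (levels m - 1) (by omega)]
        simp [estimate, extend, hj]
      · have h3 := e2 j j.2
        rw [extend_val] at h3
        simp only [extend, hj, dif_pos] at h3
        have hw := (weight_pos hN le_rfl (by omega : 1 ≤ m)).le
        exact mul_le_mul_of_nonneg_left h3 (mul_nonneg hw (by positivity))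
  exact h1.mono (by ring_nf; omega) fun _ h => h

theorem run_termProg {O : (Fin m → ℝ) → ℝ} (hm : 2 ≤ m) {s : Memory} (hs : Ready N M s)
    {p : ℝ × (Fin m → ℝ)} (hp : HasState s p) (j : Fin k) (i : Fin m) {r : ℕ}
    (hr : r < levels m) (h13 : s.idx 13 = j * m) (h14 : s.idx 14 = r) (h15 : s.idx 15 = i) :
    Run O termProg s (levels m * 6 + 14) fun s' =>
      Agree 16 s s' ∧ s'.real 16 0 =
        (1 / 2) ^ r * phi (levels m) (weight N (2 ^ r) * (p.2 + col M j) i / p.1) := by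
  have hL : (levels m : ℝ) ≠ 0 := by
    have := two_le_levels hm
    exact_mod_cast (by omega : levels m ≠ 0)
  set u := weight N (2 ^ r) * (p.2 + col M j) i / p.1 with hu
  have h1 : Run O termProg s
      (1 + ((1 + 1 + 1 + 1) + ((levels m * (1 + 5) + 5) + 1 + 1) + 1) + 1) fun s' =>
      Agree 16 s s' ∧ s'.real 16 0 = (1 / 2) ^ r * phi (levels m) u := by
    refine run_seq (run_setReal ?_)
    set s₁ := s.writeReal 17 _ _ with hs₁
    have a1 : Agree 16 s s₁ := (Agree.refl _ _).writeReal (by norm_num)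
    have e17 : s₁.real 17 0 = u := by
      simp [hs₁, RExpr.eval, IExpr.eval, h13, h14, h15, hp.1, hp.2 i, hs.job i j,
        hs.weight_table r hr, hu, col]
    clear_value s₁
    have hrest : ∀ (s₂ : Memory) (x y : ℝ), Agree 16 s s₂ → s₂.real 18 0 = x → s₂.real 19 0 = y →
        x ^ levels m + y = phi (levels m) u →
        Run O (.seq (foldReal 20 3 (.const 1) (.setInt 21 (.const 0))
          (.mul (.read 20 (.const 0)) (.read 18 (.const 0))))
        (.setReal 16 (.const 0) (.mul (.read 6 (.var 14))
          (.add (.read 20 (.const 0)) (.read 19 (.const 0)))))) s₂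
        ((levels m * (1 + 5) + 5) + 1 + 1) fun s' =>
          Agree 16 s s' ∧ s'.real 16 0 = (1 / 2) ^ r * phi (levels m) u := by
      intro s₂ x y a2 ex ey hxy
      refine run_seq (n := levels m * (1 + 5) + 5) (n' := 1) 
        (Run.imp (run_foldReal (fun n => x ^ n) (by norm_num)
        ((a2.1 3 (by norm_num)).trans hs.levels_idx) (by simp [RExpr.eval]) ?_) ?_)
      · intro l _ s' ha _ e
        refine run_setInt ⟨(Agree.refl _ _).writeInt le_rfl, ?_⟩
        simp only [RExpr.eval, IExpr.eval, Memory.writeInt_real, e, pow_succ,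
          ha.2 18 (by norm_num), ex]
      · rintro s₃ ⟨a3, e3⟩
        refine run_setReal ⟨(a2.trans (a3.mono (by norm_num))).writeReal le_rfl, ?_⟩
        simp only [Memory.writeReal_real, if_true, IExpr.eval, RExpr.eval, Function.update_self, e3,
          a3.2 19 (by norm_num), ey, a3.2 6 (by norm_num), a2.2 6 (by norm_num),
          a3.1 14 (by norm_num), a2.1 14 (by norm_num), h14, hs.scale_table r hr, hxy]
    have e3 : s₁.real 3 0 = levels m := by rw [a1.2 3 (by norm_num), hs.levels_real]
    refine run_seq (run_ite (fun hc => ?_) (fun hc => ?_))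
    · simp only [Comparison.Holds, RExpr.eval, IExpr.eval, e17, e3] at hc
      refine run_seq (run_setReal (run_setReal (hrest _ ((1 + u / levels m) / 2) 0
        ((a1.writeReal (by norm_num)).writeReal (by norm_num)) ?_ ?_ ?_)))
      · simp [RExpr.eval, IExpr.eval, e17, e3]
      · simp [RExpr.eval, IExpr.eval]
      · rw [phi, min_eq_left hc, max_eq_right (by linarith)]
    · simp only [Comparison.Holds, RExpr.eval, IExpr.eval, e17, e3, not_le] at hc
      refine run_seq (run_setReal (run_setReal (hrest _ 1 (u - levels m)
        ((a1.writeReal (by norm_num)).writeReal (by norm_num)) ?_ ?_ ?_)))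
      · simp [RExpr.eval, IExpr.eval]
      · simp [RExpr.eval, IExpr.eval, e17, e3]
      · rw [phi, min_eq_right hc.le, max_eq_left (by linarith), div_self hL]
        norm_num
  exact h1.mono (by omega) fun _ h => h

theorem run_potProg {O : (Fin m → ℝ) → ℝ} (hm : 2 ≤ m) {s : Memory} (hs : Ready N M s)
    {p : ℝ × (Fin m → ℝ)} (hp : HasState s p) (j : Fin k) (h10 : s.idx 10 = j) :
    Run O potProg s (k * 4 + levels m * (m * (levels m * 6 + 19) + 10) + 13) fun s' =>
      Agree 12 s s' ∧ s'.real 12 0 = pot N p.1 (p.2 + col M j) := by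
  set f : ℕ → ℕ → ℝ := fun r i => extend (fun i : Fin m =>
    (1 / 2) ^ r * phi (levels m) (weight N (2 ^ r) * (p.2 + col M j) i / p.1)) i with hf
  have h1 : Run O potProg s ((j * 4 + 5) +
      ((levels m * ((m * ((levels m * 6 + 14) + 5) + 5) + 5) + 5) + 1 + 1) + 1) fun s' =>
      Agree 12 s s' ∧ s'.real 12 0 = pot N p.1 (p.2 + col M j) := by
    refine run_seq (Run.imp (run_iterInt (fun i => i * m) (by norm_num) h10 (by simp [IExpr.eval])
      ?_) ?_)
    · intro i _ s' ha e
      simp only [Nat.reduceAdd] at e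
      simp only [IExpr.eval, e, ha.1 0 (by norm_num), hs.machines]; ring
    rintro s₁ ⟨a1, e1⟩
    simp only [Nat.reduceAdd] at e1
    have hs₁ := hs.of_agree (a1.mono (by norm_num))
    refine run_seq (n := levels m * ((m * ((levels m * 6 + 14) + 5) + 5) + 5) + 5) (n' := 1)
      (Run.imp (run_foldReal
      (fun n => ∑ r ∈ Finset.range n, ∑ i ∈ Finset.range m, f r i)
      (by norm_num) hs₁.levels_idx (by simp [RExpr.eval]) ?_) ?_)
    · intro r hr s₂ a2 e2 e2'
      have hs₂ := hs₁.of_agree (a2.mono (by norm_num))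
      refine Run.imp (run_foldReal (fun n => ∑ i ∈ Finset.range n, f r i) (by norm_num) hs₂.machines
        (by simp [RExpr.eval]) ?_) ?_
      · intro i hi s₃ a3 e3 e3'
        have hs₃ := hs₂.of_agree (a3.mono (by norm_num))
        have hp₃ := ((hp.of_agree a1 (by norm_num)).of_agree a2 (by norm_num)).of_agree a3
          (by norm_num)
        refine Run.imp (run_termProg hm hs₃ hp₃ j ⟨i, hi⟩ hr ?_ ?_ e3) ?_
        · rw [a3.1 13 (by norm_num), a2.1 13 (by norm_num), e1]
        · rw [a3.1 14 (by norm_num), e2]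
        · rintro s₄ ⟨a4, e4⟩
          refine ⟨a4, ?_⟩
          rw [Finset.sum_range_succ, ← e3']
          simp [RExpr.eval, IExpr.eval, e4, a4.2 15 (by norm_num), hf, extend, hi]
      · rintro s₃ ⟨a3, e3⟩
        refine ⟨a3, ?_⟩
        rw [Finset.sum_range_succ, ← e2']
        simp only [RExpr.eval, IExpr.eval, e3, a3.2 14 (by norm_num)]
    · rintro s₂ ⟨a2, e2⟩
      refine run_setReal ⟨(a1.trans (a2.mono (by norm_num))).writeReal le_rfl, ?_⟩
      simp only [Memory.writeReal_real, if_true, IExpr.eval, RExpr.eval, Function.update_self, e2]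
      unfold pot
      refine Finset.sum_congr rfl fun r _ => ?_
      rw [Finset.sum_range, Finset.mul_sum]
      exact Finset.sum_congr rfl fun i _ => extend_val _ i
  refine h1.mono ?_ fun _ h => h
  have := j.2
  ring_nf
  omega

theorem run_bumpProg {O : (Fin m → ℝ) → ℝ} {s : Memory} (hs : Ready N M s)
    {p : ℝ × (Fin m → ℝ)} (hp : HasState s p) {a : ℝ} (h8 : s.real 8 0 = a) :
    Run O bumpProg s (m * 6 + 6) fun s' =>
      Ready N M s' ∧ HasState s' (max (2 * p.1) a, (0 : Fin m → ℝ)) ∧ s'.real 8 0 = a ∧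
        s'.idx 9 = s.idx 9 := by
  have h1 : Run O bumpProg s ((1 + 1) + (m * (1 + 5) + 3) + 1) fun s' =>
      Ready N M s' ∧ HasState s' (max (2 * p.1) a, (0 : Fin m → ℝ)) ∧ s'.real 8 0 = a ∧
        s'.idx 9 = s.idx 9 := by
    have hrest : ∀ s₁ : Memory, AgreeExcept 12 1 s s₁ → s₁.real 1 0 = max (2 * p.1) a →
        Run O (writeLoop 12 2 0 (.setReal 13 (.const 0) (.const 0))) s₁ (m * (1 + 5) + 3)
        fun s' => Ready N M s' ∧ HasState s' (max (2 * p.1) a, (0 : Fin m → ℝ)) ∧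
          s'.real 8 0 = a ∧ s'.idx 9 = s.idx 9 := by
      intro s₁ a1 e1
      have hs₁ := hs.of_agreeExcept (a1.mono (by norm_num)) (Or.inl rfl)
      refine Run.imp (run_writeLoop (fun _ => 0) (by norm_num) (by norm_num) hs₁.machines ?_) ?_
      · intro i _ s' _ _ _
        exact run_setReal ⟨(Agree.refl _ _).writeReal le_rfl, by simp [RExpr.eval, IExpr.eval]⟩
      · rintro s₂ ⟨a2, e2⟩
        refine ⟨hs₁.of_agreeExcept (a2.mono (by norm_num)) (Or.inr rfl), ⟨?_, fun i => ?_⟩, ?_, ?_⟩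
        · rw [a2.2 1 (by norm_num) (by norm_num), e1]
        · exact e2 i i.2
        · rw [a2.2 8 (by norm_num) (by norm_num), a1.2 8 (by norm_num) (by norm_num), h8]
        · rw [a2.1 9 (by norm_num), a1.1 9 (by norm_num)]
    refine run_seq (run_ite (fun hc => ?_) (fun hc => ?_))
    all_goals
      simp only [Comparison.Holds, RExpr.eval, IExpr.eval, hp.1, h8] at hc
      refine run_setReal (hrest _ (Agree.refl _ _).except.writeReal ?_)
      simp only [Memory.writeReal_real, if_true, IExpr.eval, RExpr.eval, Function.update_self, h8,
        hp.1]
    · rw [max_eq_right (by linarith)]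
    · rw [max_eq_left (by linarith)]; ring
  exact h1.mono (by omega) fun _ h => h

/-- The state of the loop of attempts after `i` iterations, of which the last one, if the flag is
set, found an acceptable option. -/
def AttemptInv (N : Seminorm ℝ (Fin m → ℝ)) (M : Matrix (Fin m) (Fin k) ℝ) (a : ℝ)
    (p : ℝ × (Fin m → ℝ)) (i : ℕ) (s : Memory) : Prop :=
  Ready N M s ∧ s.real 8 0 = a ∧ ∃ q, HasState s q ∧ Relation.ReflTransGen (Bump N M a) p q ∧
    ((s.idx 9 = 0 ∧ i ≤ levels m + 2 ∧ (1 ≤ i → q.2 = 0 ∧ 2 ^ (i - 1) * a ≤ q.1)) ∨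
     (s.idx 9 = 1 ∧ a ≤ q.1 ∧ ∃ j : Fin k, s.idx 11 = j ∧ IsGreedy N M q.1 q.2 j ∧
        pot N q.1 (q.2 + col M j) ≤ 2 * levels m))

/-- The number of steps of `attemptProg`. -/
def attemptTime (m k L : ℕ) : ℕ :=
  k * (k * 4 + L * (m * (L * 6 + 19) + 10) + 22) + m * 6 + 12

theorem run_attemptProg {O : (Fin m → ℝ) → ℝ} (hN : IsMonotoneSymmetricNorm N) (hm : 2 ≤ m)
    (hk : 1 ≤ k) (hM : ∀ i j, 0 ≤ M i j) {j₀ : Fin k} (ha : 0 < estimate N M j₀)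
    {p : ℝ × (Fin m → ℝ)} {i : ℕ} {s : Memory} (h : AttemptInv N M (estimate N M j₀) p i s)
    (h9 : s.idx 9 = 0) :
    Run O attemptProg s (attemptTime m k (levels m))
      (AttemptInv N M (estimate N M j₀) p (i + 1)) := by
  obtain ⟨hs, h8, q, hq, hpq, ⟨-, hi, hiq⟩ | ⟨h9', -⟩⟩ := h
  swap
  · omega
  set a := estimate N M j₀ with hadef
  have h1 : Run O attemptProg s
      ((k * ((k * 4 + levels m * (m * (levels m * 6 + 19) + 10) + 13) + 9) + 3) +
        ((m * 6 + 6) + 1 + 1) + 1) (AttemptInv N M a p (i + 1)) := by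
    refine run_seq (Run.imp (run_argmin (extend fun j => pot N q.1 (q.2 + col M j)) hk (by norm_num)
      hs.options ?_) ?_)
    · intro j hj s' ha' e
      have := run_potProg (O := O) hm (hs.of_agree (ha'.mono (by norm_num)))
        (hq.of_agree ha' (by norm_num)) ⟨j, hj⟩ e
      simpa only [extend, hj, dif_pos] using this
    rintro s₁ ⟨a1, hj, e1, e2⟩
    simp only [Nat.reduceAdd] at hj e1 e2
    have hs₁ := hs.of_agree (a1.mono (by norm_num))
    have hq₁ := hq.of_agree a1 (by norm_num)
    have h8₁ : s₁.real 8 0 = a := by rw [a1.2 8 (by norm_num), h8]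
    have h9₁ : s₁.idx 9 = 0 := by rw [a1.1 9 (by norm_num), h9]
    set j : Fin k := ⟨s₁.idx 11, hj⟩ with hjdef
    have hbest : s₁.real 10 0 = pot N q.1 (q.2 + col M j) := by
      rw [e1]; exact extend_val _ j
    have hgreedy : IsGreedy N M q.1 q.2 j := by
      intro j'
      have h3 := e2 j' j'.2
      rw [extend_val] at h3
      exact (extend_val (fun j => pot N q.1 (q.2 + col M j)) j).symm.trans_le h3
    have hbump : (q.1 < a ∨ 2 * (levels m : ℝ) < pot N q.1 (q.2 + col M j)) →
        Run O bumpProg s₁ (m * 6 + 6) (AttemptInv N M a p (i + 1)) := by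
      intro hfail
      refine Run.imp (run_bumpProg hs₁ hq₁ h8₁) ?_
      rintro s₂ ⟨hs₂, hq₂, h8₂, h9₂⟩
      have hstep : Bump N M a q (max (2 * q.1) a, 0) :=
        ⟨hfail.imp id fun hf => ⟨j, hgreedy, hf⟩, rfl⟩
      refine ⟨hs₂, h8₂, _, hq₂, hpq.tail hstep, Or.inl ⟨h9₂.trans h9₁, ?_, fun _ => ⟨rfl, ?_⟩⟩⟩
      · -- After `levels m + 2` new phases the scale is large enough for the job alone.
        by_contra hlt
        have hi' : i = levels m + 2 := by omega
        obtain ⟨hq0, hqa⟩ := hiq (by omega)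
        rw [hi', show levels m + 2 - 1 = levels m + 1 by omega] at hqa
        rw [hq0] at hfail hgreedy
        have hok := pot_greedy_le hN hm hM ha hqa hgreedy
        rcases hfail with hf | hf
        · have : (1 : ℝ) ≤ 2 ^ (levels m + 1) := one_le_pow₀ (by norm_num)
          nlinarith
        · linarith
      · rcases Nat.eq_zero_or_pos i with h0 | hpos
        · simp [h0]
        · obtain ⟨-, hqa⟩ := hiq hpos
          refine le_trans ?_ (le_max_left _ _)
          have he : (2 : ℝ) ^ (i + 1 - 1) = 2 * 2 ^ (i - 1) := by
            rw [← pow_succ']; congr 1; omega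
          rw [he]
          linarith
    refine run_ite (fun hc => ?_) (fun hc => ?_)
    · simp only [Comparison.Holds, RExpr.eval, IExpr.eval, hq₁.1, h8₁] at hc
      refine run_ite (fun hc2 => ?_) (fun hc2 => ?_)
      · simp only [Comparison.Holds, RExpr.eval, IExpr.eval, hbest, hs₁.levels_real] at hc2
        refine (run_setInt ?_).mono (by omega : 1 ≤ m * 6 + 6) fun _ h => h
        have a2 : Agree 9 s₁ (s₁.writeInt 9 (IExpr.eval s₁ (.const 1))) :=
          (Agree.refl _ _).writeInt le_rfl
        refine ⟨hs₁.of_agree (a2.mono (by norm_num)), by simpa using h8₁, q,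
          hq₁.of_agree a2 (by norm_num), hpq, Or.inr ⟨by simp [IExpr.eval], hc, j, ?_, hgreedy, ?_⟩⟩
        · simp [hjdef]
        · linarith
      · simp only [Comparison.Holds, RExpr.eval, IExpr.eval, hbest, hs₁.levels_real, not_le] at hc2
        exact hbump (Or.inr (by linarith))
    · simp only [Comparison.Holds, RExpr.eval, IExpr.eval, hq₁.1, h8₁, not_le] at hc
      exact (hbump (Or.inl hc)).mono (by omega) fun _ h => h
  exact h1.mono (by unfold attemptTime; ring_nf; omega) fun _ h => h

theorem run_acceptProg {O : (Fin m → ℝ) → ℝ} {s : Memory} (hs : Ready N M s)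
    {p : ℝ × (Fin m → ℝ)} (hp : HasState s p) (j : Fin k) (h11 : s.idx 11 = j) :
    Run O acceptProg s (k * 4 + m * 6 + 11) fun s' =>
      (s'.idx 0 = m ∧ s'.idx 1 = k) ∧ s'.idx 2 = j ∧ HasState s' (p.1, p.2 + col M j) := by
  have h1 : Run O acceptProg s (1 + ((j * 4 + 5) + (m * (1 + 5) + 3) + 1) + 1) fun s' =>
      (s'.idx 0 = m ∧ s'.idx 1 = k) ∧ s'.idx 2 = j ∧ HasState s' (p.1, p.2 + col M j) := by
    refine run_seq (run_setInt ?_)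
    refine run_seq (Run.imp (run_iterInt (fun i => i * m) (n := j) (by norm_num) (by simp [h11])
      (by simp [IExpr.eval]) ?_) ?_)
    · intro i _ s' ha e
      simp only [Nat.reduceAdd] at e
      simp only [IExpr.eval, e, ha.1 0 (by norm_num), Memory.writeInt_idx]
      simp only [OfNat.zero_ne_ofNat, if_false, hs.machines]
      ring
    rintro s₁ ⟨a1, e1⟩
    simp only [Nat.reduceAdd] at e1
    have i0 : s₁.idx 0 = m := by rw [a1.1 0 (by norm_num)]; simp [hs.machines]
    have i1 : s₁.idx 1 = k := by rw [a1.1 1 (by norm_num)]; simp [hs.options]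
    have i2 : s₁.idx 2 = j := by rw [a1.1 2 (by norm_num)]; simp [IExpr.eval, h11]
    have r0 : s₁.real 0 = s.real 0 := by rw [a1.2 0 (by norm_num)]; rfl
    have r1 : s₁.real 1 = s.real 1 := by rw [a1.2 1 (by norm_num)]; rfl
    have r2 : s₁.real 2 = s.real 2 := by rw [a1.2 2 (by norm_num)]; rfl
    refine Run.imp (run_writeLoop (fun i => s.real 2 i + s.real 0 (j * m + i))
      (by norm_num) (by norm_num)
      i0 ?_) ?_
    · intro i _ s' ha hrest e
      refine run_setReal ⟨(Agree.refl _ _).writeReal le_rfl, ?_⟩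
      simp only [Nat.reduceAdd, Memory.writeReal_real, if_true, IExpr.eval, RExpr.eval,
        Function.update_self, e, hrest i le_rfl, ha.2 0 (by norm_num) (by norm_num),
        ha.1 13 (by norm_num), e1, r0, r2]
    · rintro s₂ ⟨a2, e2⟩
      refine ⟨⟨(a2.1 0 (by norm_num)).trans i0, (a2.1 1 (by norm_num)).trans i1⟩,
        (a2.1 2 (by norm_num)).trans i2, ?_, fun i => ?_⟩
      · rw [a2.2 1 (by norm_num) (by norm_num), r1]; exact hp.1
      · rw [e2 i i.2, hp.2 i, hs.job i j]; rfl
  exact h1.mono (by have := j.2; omega) fun _ h => h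

/-- The number of steps for one job, where `L` stands for `levels m`. -/
def jobTime (m k L : ℕ) : ℕ :=
  (L * 6 + 7) + ((L * (L * 10 + m * 8 + 24) + L * (L * 6 + 10) + 7) +
    ((k * (k * 4 + m * 6 + 22) + 5) +
      ((1 + (((L + 3) * (attemptTime m k L + 1) + 1) + (k * 4 + m * 6 + 11) + 1) + 1) + 1) + 1) + 1)
    + 1

theorem run_jobProg (hN : IsMonotoneSymmetricNorm N) (hm : 2 ≤ m) (hk : 1 ≤ k)
    (hM : ∀ i j, 0 ≤ M i j) {s : Memory} (h0 : s.idx 0 = m) (h1 : s.idx 1 = k)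
    {p : ℝ × (Fin m → ℝ)} (hp : HasState s p) :
    Run (ballOpt N) jobProg (s.receive M) (jobTime m k (levels m)) fun s' =>
      (s'.idx 0 = m ∧ s'.idx 1 = k) ∧ ∃ (j : Fin k) (q : ℝ × (Fin m → ℝ)), s'.idx 2 = j ∧
        HasState s' q ∧ JobSpec N M p q j := by
  have hp' : HasState (s.receive M) p := hp
  have hjob : ∀ (i : Fin m) (j : Fin k), (s.receive M).real 0 (j * m + i) = M i j := by
    intro i j
    have e1 : ((j : ℕ) * m + i) % m = i := by
      rw [mul_comm, Nat.mul_add_mod, Nat.mod_eq_of_lt i.2]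
    have e2 : ((j : ℕ) * m + i) / m = j := by
      rw [mul_comm, Nat.mul_add_div (by omega), Nat.div_eq_of_lt i.2, add_zero]
    simp [Memory.receive, e1, e2]
  have h0' : (s.receive M).idx 0 = m := h0
  have h1' : (s.receive M).idx 1 = k := h1
  generalize s.receive M = s₀ at hp' hjob h0' h1'
  unfold jobProg jobTime
  refine run_seq (Run.imp (run_levelsProg hm h0') ?_)
  rintro s₁ ⟨a1, e1, e1'⟩
  refine run_seq (Run.imp (run_tablesProg (N := N) ((a1.1 0 (by norm_num)).trans h0') e1) ?_)
  rintro s₂ ⟨a2, e2, e2'⟩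
  have hs₂ : Ready N M s₂ := by
    refine ⟨?_, ?_, ?_, ?_, e2, e2', fun i j => ?_⟩
    · rw [a2.1 0 (by norm_num), a1.1 0 (by norm_num), h0']
    · rw [a2.1 1 (by norm_num), a1.1 1 (by norm_num), h1']
    · rw [a2.1 3 (by norm_num), e1]
    · rw [a2.2 3 (by norm_num), e1']
    · rw [a2.2 0 (by norm_num), a1.2 0 (by norm_num), hjob]
  have hp₂ := (hp'.of_agree a1 le_rfl).of_agree a2 (by norm_num)
  refine run_seq (Run.imp (run_estimateProg hN hm hk hs₂) ?_)
  rintro s₃ ⟨a3, j₀, e3, e3', hj₀⟩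
  have hs₃ := hs₂.of_agree a3
  have hp₃ := hp₂.of_agree a3 (by norm_num)
  refine run_ite (fun hc => ?_) (fun hc => ?_)
  · simp only [Comparison.Holds, RExpr.eval, IExpr.eval, e3', Rat.cast_zero] at hc
    refine (run_setInt ?_).mono (by omega : 1 ≤ _) fun _ h => h
    refine ⟨⟨?_, ?_⟩, j₀, p, ?_, hp₃, j₀, hj₀, Or.inl ⟨hc, rfl, rfl⟩⟩
    · simpa using hs₃.machines
    · simpa using hs₃.options
    · simpa [IExpr.eval] using e3
  · simp only [Comparison.Holds, RExpr.eval, IExpr.eval, e3', Rat.cast_zero, not_le] at hc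
    refine run_seq (run_setInt (run_seq (Run.imp (run_loop
      (AttemptInv N M (estimate N M j₀) p) (Q := fun s' => Ready N M s' ∧ ∃ q, HasState s' q ∧
        Relation.ReflTransGen (Bump N M (estimate N M j₀)) p q ∧ estimate N M j₀ ≤ q.1 ∧
        ∃ j : Fin k, s'.idx 11 = j ∧ IsGreedy N M q.1 q.2 j ∧
          pot N q.1 (q.2 + col M j) ≤ 2 * levels m) ?_ ?_ ?_) ?_)))
    · have a4 : Agree 9 s₃ (s₃.writeInt 9 (IExpr.eval s₃ (.const 0))) :=
        (Agree.refl _ _).writeInt le_rfl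
      exact ⟨hs₃.of_agree (a4.mono (by norm_num)), by simpa using e3', p,
        hp₃.of_agree a4 (by norm_num), Relation.ReflTransGen.refl,
        Or.inl ⟨by simp [IExpr.eval], Nat.zero_le _, fun h => by omega⟩⟩
    · intro i s' hinv hcond
      simp only [Comparison.Holds, IExpr.eval, Nat.le_zero] at hcond
      refine ⟨?_, run_attemptProg hN hm hk hM hc hinv hcond⟩
      obtain ⟨-, -, q, -, -, ⟨-, hi, -⟩ | ⟨h9, -⟩⟩ := hinv <;> omega
    · intro i s' hinv hcond
      simp only [Comparison.Holds, IExpr.eval, Nat.le_zero] at hcond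
      obtain ⟨hs, -, q, hq, hpq, ⟨h9, -⟩ | ⟨-, hrest⟩⟩ := hinv
      · exact absurd h9 hcond
      · exact ⟨hs, q, hq, hpq, hrest⟩
    · rintro s₄ ⟨hs₄, q, hq, hpq, haq, j, hj, hg, hpot⟩
      refine Run.imp (run_acceptProg hs₄ hq j hj) ?_
      rintro s₅ ⟨hmk, h2, hst⟩
      exact ⟨hmk, j, _, h2, hst, j₀, hj₀, Or.inr ⟨hc, q, hpq, haq, hg, hpot, rfl⟩⟩

end Correctness

/-! ### The online algorithm carried out by the program -/

section Algorithm

variable {m k : ℕ} {N : Seminorm ℝ (Fin m → ℝ)}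

/-- The memory after `t` jobs, when the program may use `n` steps for each of them. -/
noncomputable def memAfter (N : Seminorm ℝ (Fin m → ℝ)) (n : ℕ)
    (J : ℕ → Matrix (Fin m) (Fin k) ℝ) : ℕ → Memory
  | 0 => startMemory m k
  | t + 1 => ((step (ballOpt N))^[n] ([jobProg], (memAfter N n J t).receive (J t))).2

theorem memAfter_congr {n : ℕ} {J J' : ℕ → Matrix (Fin m) (Fin k) ℝ} {t : ℕ}
    (h : ∀ s < t, J s = J' s) : memAfter N n J t = memAfter N n J' t := by
  induction t with
  | zero => rfl
  | succ t ih =>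
    rw [memAfter, memAfter, ih fun s hs => h s (by omega), h t (by omega)]

/-- The online algorithm whose selections are the outputs of the program. -/
noncomputable def programAlgorithm (N : Seminorm ℝ (Fin m → ℝ)) (n : ℕ) (hk : 1 ≤ k) :
    OnlineAlgorithm m k :=
  fun t H =>
    let s := memAfter N n (fun r => if h : r < t + 1 then H ⟨r, h⟩ else 0) (t + 1)
    if h : s.idx 2 < k then ⟨s.idx 2, h⟩ else ⟨0, hk⟩

theorem programAlgorithm_choice {n : ℕ} (hk : 1 ≤ k) (J : ℕ → Matrix (Fin m) (Fin k) ℝ) {t : ℕ}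
    {j : Fin k} (h : (memAfter N n J (t + 1)).idx 2 = j) :
    (programAlgorithm N n hk).choice J t = j := by
  have hc : memAfter N n (fun r => if _ : r < t + 1 then J r else 0) (t + 1) =
      memAfter N n J (t + 1) := memAfter_congr fun s hs => by simp [hs]
  have e : (memAfter N n (fun r => if _ : r < t + 1 then J r else 0) (t + 1)).idx 2 = j := by
    rw [hc, h]
  simp only [OnlineAlgorithm.choice, programAlgorithm, e, j.2, dif_pos]

/-- The scale and the load of the current phase that are stored in the memory. -/
def storedState (s : Memory) : ℝ × (Fin m → ℝ) := (s.real 1 0, fun i => s.real 2 i)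

theorem HasState.eq_storedState {s : Memory} {p : ℝ × (Fin m → ℝ)} (h : HasState s p) :
    p = storedState s :=
  Prod.ext h.1.symm (funext fun i => (h.2 i).symm)

theorem memAfter_spec (hN : IsMonotoneSymmetricNorm N) (hm : 2 ≤ m) (hk : 1 ≤ k)
    {J : ℕ → Matrix (Fin m) (Fin k) ℝ} (hJ : ∀ t i j, 0 ≤ J t i j) (t : ℕ) :
    let mem := memAfter N (jobTime m k (levels m)) J
    let x := (programAlgorithm N (jobTime m k (levels m)) hk).choice J t
    ((mem t).idx 0 = m ∧ (mem t).idx 1 = k) ∧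
      HaltsWithin (ballOpt N) jobProg ((mem t).receive (J t)) (jobTime m k (levels m))
        (mem (t + 1)) ∧ (mem (t + 1)).idx 2 = x ∧
      JobSpec N (J t) (storedState (mem t)) (storedState (mem (t + 1))) x := by
  intro mem x
  have hstep : (mem t).idx 0 = m → (mem t).idx 1 = k →
      HaltsWithin (ballOpt N) jobProg ((mem t).receive (J t)) (jobTime m k (levels m))
        (mem (t + 1)) ∧ ((mem (t + 1)).idx 0 = m ∧ (mem (t + 1)).idx 1 = k) ∧
      (mem (t + 1)).idx 2 = x ∧
      JobSpec N (J t) (storedState (mem t)) (storedState (mem (t + 1))) x := by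
    intro h0 h1
    obtain ⟨s', hs', hmk, j, q, hj, hq, hspec⟩ := (run_jobProg hN hm hk (hJ t) h0 h1
      (p := storedState (mem t)) ⟨rfl, fun _ => rfl⟩).haltsWithin
    have e : mem (t + 1) = s' := by
      have h2 := congrArg Prod.snd hs'
      exact h2
    have ex : x = j := programAlgorithm_choice hk J ((congrArg (Memory.idx · 2) e).trans hj)
    rw [e, ex, ← hq.eq_storedState]
    exact ⟨hs', hmk, hj, hspec⟩
  have hmk : ∀ t, (mem t).idx 0 = m ∧ (mem t).idx 1 = k := by
    intro t
    induction t with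
    | zero => exact ⟨rfl, rfl⟩
    | succ t ih =>
      obtain ⟨s', hs', hmk, -⟩ := (run_jobProg hN hm hk (hJ t) ih.1 ih.2
        (p := storedState (mem t)) ⟨rfl, fun _ => rfl⟩).haltsWithin
      have e : mem (t + 1) = s' := congrArg Prod.snd hs'
      rw [e]
      exact hmk
  obtain ⟨h1, -, h2, h3⟩ := hstep (hmk t).1 (hmk t).2
  exact ⟨hmk t, h1, h2, h3⟩

/-- The polynomial whose value at `n` is `jobTime n n n`. -/
noncomputable def jobPoly : Polynomial ℕ :=
  let X := (Polynomial.X : Polynomial ℕ)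
  (X * 6 + 7) + ((X * (X * 10 + X * 8 + 24) + X * (X * 6 + 10) + 7) +
    ((X * (X * 4 + X * 6 + 22) + 5) +
      ((1 + (((X + 3) * ((X * (X * 4 + X * (X * (X * 6 + 19) + 10) + 22) + X * 6 + 12) + 1) + 1) +
        (X * 4 + X * 6 + 11) + 1) + 1) + 1) + 1) + 1) + 1

theorem eval_jobPoly (n : ℕ) : jobPoly.eval n = jobTime n n n := by
  simp [jobPoly, jobTime, attemptTime]

theorem jobTime_le_eval (hm : 2 ≤ m) (hk : 1 ≤ k) (t : ℕ) :
    jobTime m k (levels m) ≤ jobPoly.eval (m * k * (t + 1)) := by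
  have h1 : m ≤ m * k * (t + 1) := by
    rw [mul_assoc]; exact Nat.le_mul_of_pos_right m (by positivity)
  have h2 : k ≤ m * k * (t + 1) := by
    rw [mul_comm m k, mul_assoc]; exact Nat.le_mul_of_pos_right k (by positivity)
  have h3 : levels m ≤ m * k * (t + 1) := le_trans (Nat.log_lt_self 2 (by omega)) h1
  rw [eval_jobPoly]
  generalize m * k * (t + 1) = n at h1 h2 h3
  unfold jobTime attemptTime
  gcongr

end Algorithm

end OnlineLoadBalancing

/-- There are a constant `C`, one program `P` and a polynomial `p` such that for every number
`m ≥ 2` of machines, every number `k ≥ 1` of options and every monotone symmetric norm `N` on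
`ℝ^m`, the program `P` with the Ball-Optimization oracle of `N` carries out a `C log² m`-competitive
online algorithm and uses at most `p (m * k * (t + 1))` steps for job `t`. -/
theorem mainTheorem3 :
    ∃ (C : ℝ) (P : OnlineLoadBalancing.Program) (p : Polynomial ℕ),
      ∀ (m k : ℕ) (N : Seminorm ℝ (Fin m → ℝ)),
        2 ≤ m → 1 ≤ k → OnlineLoadBalancing.IsMonotoneSymmetricNorm N →
          ∃ A : OnlineLoadBalancing.OnlineAlgorithm m k,
            OnlineLoadBalancing.IsCompetitive N A (C * Real.log m ^ 2) ∧
            OnlineLoadBalancing.Computes (OnlineLoadBalancing.ballOpt N) P A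
              (fun t => p.eval (m * k * (t + 1))) := by
  refine ⟨864, OnlineLoadBalancing.jobProg, OnlineLoadBalancing.jobPoly, fun m k N hm hk hN => ?_⟩
  refine ⟨OnlineLoadBalancing.programAlgorithm N
    (OnlineLoadBalancing.jobTime m k (OnlineLoadBalancing.levels m)) hk, fun J hJ T => ?_,
    fun J hJ => ⟨OnlineLoadBalancing.memAfter N
      (OnlineLoadBalancing.jobTime m k (OnlineLoadBalancing.levels m)) J, rfl, fun t => ?_⟩⟩
  · have h := OnlineLoadBalancing.norm_load_le_OPT hN hm hJ hk (st := fun t =>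
        OnlineLoadBalancing.storedState (OnlineLoadBalancing.memAfter N
          (OnlineLoadBalancing.jobTime m k (OnlineLoadBalancing.levels m)) J t))
      rfl (fun t => (OnlineLoadBalancing.memAfter_spec hN hm hk hJ t).2.2.2) T
    rw [OnlineLoadBalancing.totalLoad_eq_load T (OnlineLoadBalancing.OnlineAlgorithm.choice _ J)]
    have hL := OnlineLoadBalancing.levels_sq_le hm
    have hO := OnlineLoadBalancing.OPT_nonneg (N := N) (J := J) hk T
    exact h.trans (mul_le_mul_of_nonneg_right (by linarith) hO)
  · have h := OnlineLoadBalancing.memAfter_spec hN hm hk hJ t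
    exact ⟨h.2.1.mono (OnlineLoadBalancing.jobTime_le_eval hm hk t), h.2.2.1⟩
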